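/- **Setting.** Let $(\Omega^\bullet,\mathrm d)$ be a differential $*$-calculus over a unital complex $*$-algebra $B=\Omega^0$: a differential graded algebra generated by $B$ and $\mathrm dB$, with a conjugate-linear involution commuting with $\mathrm d$ and satisfying $(\omega\wedge\nu)^*=(-1)^{kl}\nu^*\wedge\omega^*$ for $\omega\in\Omega^k,\nu\in\Omega^l$. Let $(\Omega^{(\bullet,\bullet)},\kappa)$ be a Kähler structure of total degree $2n$ on it: an algebra grading $\Omega^k=\bigoplus_{a+b=k}\Omega^{(a,b)}$ with $(\Omega^{(a,b)})^*=\Omega^{(b,a)}$ and $\mathrm d=\partial+\bar\partial$, where $\partial,\bar\partial$ have bidegrees $(1,0)$ and $(0,1)$; $\Omega^{2n}\neq0$ and $\Omega^k=0$ for $k>2n$; and a closed, central, real $(1,1)$-form $\kappa$ such that, with $L\omega=\kappa\wedge\omega$, the maps $L^{n-k}:\Omega^k\to\Omega^{2n-k}$ are bijective for $0\le k<n$. The Hodge map $*$ is the linear map with $*(L^j\alpha)=(-1)^{k(k+1)/2}\,\mathbf i^{a-b}\,\frac{j!}{(n-j-k)!}L^{n-j-k}\alpha$ for primitive $\alpha\in\Omega^{(a,b)}$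 (that is, $k=a+b\le n$ and $L^{n-k+1}\alpha=0$) and $0\le j\le n-k$. The metric is $g(\omega,\nu)=*(\omega\wedge*(\nu^*))$ for forms of equal degree, and $0$ for forms of different degrees. Let $\mathbf f:B\to\mathbb C$ be a state (linear, with $\mathbf f(b^*b)>0$ for all $b\ne0$) such that the integral $\int=\mathbf f\circ *:\Omega^{2n}\to\mathbb C$ is closed, i.e. $\int\mathrm d\omega=0$ for $\omega\in\Omega^{2n-1}$. Let $(\mathcal F,h_{\mathcal F},\bar\partial_{\mathcal F})$ be an Hermitian holomorphic module. That is, $\mathcal F$ is a finitely generated projective left $B$-module. The pairing $h_{\mathcal F}:\mathcal F\times\mathcal F\to B$ is sesquilinear and conjugate symmetric and induces an isomorphism $\overline{\mathcal F}\cong{}_B\mathrm{Hom}(\mathcal F,B)$ of right $B$-modules; for $f\ne0$, $h_{\mathcal F}(f,f)$ is a non-zero element of the cone of finite sums of elements $b^*b$. Finally, $\bar\partial_{\mathcal F}:\mathcal F\to\Omega^{(0,1)}\otimes_B\mathcal F$ is a flat $(0,1)$-connection, extended to $\Omega^\bullet\otimes_B\mathcal F$ by $\bar\partial_{\mathcal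 F}(\omega\otimes f)=\bar\partial\omega\otimes f+(-1)^{|\omega|}\omega\wedge\bar\partial_{\mathcal F}f$. Put $\langle\omega\otimes f,\nu\otimes k\rangle_{\mathcal F}=\mathbf f\big(g(\omega\,h_{\mathcal F}(f,k),\nu)\big)$ and assume that $\langle\cdot,\cdot\rangle_{\mathcal F}$ is an inner product (positive definite) on $\Omega^\bullet\otimes_B\mathcal F$. Assume that $\mathcal F$ is negative with curvature constant $\theta>0$: the Chern connection $\nabla$ of $\mathcal F$ (the connection with $\mathrm d\,h_{\mathcal F}(f,k)=h_{\mathcal F}(\nabla f,1\otimes k)+h_{\mathcal F}(1\otimes f,\nabla k)$, where $h_{\mathcal F}(\omega\otimes f,\nu\otimes k)=\omega\, h_{\mathcal F}(f,k)\wedge\nu^*$, and with $(0,1)$-part $\bar\partial_{\mathcal F}$) satisfies $\nabla^2(f)=\theta\,\mathbf i\,\kappa\otimes f$ for all $f\in\mathcal F$. **Theorem.** The operator $\bar\partial_{\mathcal F}$ on $\Omega^\bullet\otimes_B\mathcal F$ is adjointable with respect to $\langle\cdot,\cdot\rangle_{\mathcal F}$, and $D_{\bar\partial_{\mathcal F}}:=\bar\partial_{\mathcal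 F}+\bar\partial_{\mathcal F}^\dagger$ and $\Delta_{\bar\partial_{\mathcal F}}:=D_{\bar\partial_{\mathcal F}}^2$ preserve $\Omega^{(0,\bullet)}\otimes_B\mathcal F$. If the Dolbeault–Dirac operator $D_{\bar\partial_{\mathcal F}}$ is diagonalisable on $\Omega^{(0,\bullet)}\otimes_B\mathcal F$ (i.e. this space is spanned by eigenvectors of $D_{\bar\partial_{\mathcal F}}$), then: 1. every non-zero eigenvalue of $\Delta_{\bar\partial_{\mathcal F}}:\Omega^{(0,\bullet)}\otimes_B\mathcal F\to\Omega^{(0,\bullet)}\otimes_B\mathcal F$ is real and at least $\theta$; 2. every non-zero eigenvalue $\mu$ of $D_{\bar\partial_{\mathcal F}}:\Omega^{(0,\bullet)}\otimes_B\mathcal F\to\Omega^{(0,\bullet)}\otimes_B\mathcal F$ satisfies $|\mu|\ge\sqrt\theta$. -/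

import Mathlib

open scoped TensorProduct

noncomputable section

namespace NCKahler

/-! ## Differential calculi, star calculi, complex structures, Kähler structures -/

/-- A differential calculus over `ℂ`: a differential graded algebra `(Ω, d)` that is generated as an
algebra by `Ω⁰` and `d Ω⁰`. It is a calculus over its degree zero part `B = Ω⁰`. -/
structure DifferentialCalculus (Ω : Type*) [Ring Ω] [Algebra ℂ Ω] where
  /-- the homogeneous part `Ωᵏ` -/
  gr : ℕ → Submodule ℂ Ω
  graded : GradedAlgebra gr
  /-- the exterior derivative -/
  d : Ω →ₗ[ℂ] Ω
  d_mem : ∀ {k : ℕ} {ω : Ω}, ω ∈ gr k → d ω ∈ gr (k + 1)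
  d_d : ∀ ω : Ω, d (d ω) = 0
  d_mul : ∀ {k : ℕ} {ω : Ω}, ω ∈ gr k → ∀ η : Ω,
    d (ω * η) = d ω * η + (-1 : ℂ) ^ k • (ω * d η)
  generated : Algebra.adjoin ℂ ((gr 0 : Set Ω) ∪ d '' (gr 0 : Set Ω)) = ⊤

/-- A differential `*`-calculus: a conjugate linear involution with `d (ω^*) = (d ω)^*` and
`(ω ∧ ν)^* = (-1)^{kl} ν^* ∧ ω^*` for `ω ∈ Ωᵏ`, `ν ∈ Ωˡ`. -/
structure StarCalculus (Ω : Type*) [Ring Ω] [Algebra ℂ Ω] extends DifferentialCalculus Ω where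
  /-- the `*`-map of `Ω` -/
  st : Ω →ₛₗ[starRingEnd ℂ] Ω
  st_st : ∀ ω : Ω, st (st ω) = ω
  st_mem : ∀ {k : ℕ} {ω : Ω}, ω ∈ gr k → st ω ∈ gr k
  st_d : ∀ ω : Ω, st (d ω) = d (st ω)
  st_mul : ∀ {k l : ℕ} {ω η : Ω}, ω ∈ gr k → η ∈ gr l →
    st (ω * η) = (-1 : ℂ) ^ (k * l) • (st η * st ω)

/-- A complex structure on a differential `*`-calculus: an `ℕ × ℕ`-grading `Ω^{(a,b)}` of the
algebra `Ω`, refining the given grading and reversed by `*`, such that `d = ∂ + ∂̄` with `∂` of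
degree `(1,0)` and `∂̄` of degree `(0,1)`. -/
structure ComplexStructure (Ω : Type*) [Ring Ω] [Algebra ℂ Ω] extends StarCalculus Ω where
  /-- the bihomogeneous part `Ω^{(a,b)}` -/
  bi : ℕ × ℕ → Submodule ℂ Ω
  bigraded : GradedAlgebra bi
  gr_eq : ∀ k : ℕ, gr k = ⨆ (p : ℕ × ℕ) (_ : p.1 + p.2 = k), bi p
  st_bi : ∀ {a b : ℕ} {ω : Ω}, ω ∈ bi (a, b) → st ω ∈ bi (b, a)
  /-- the holomorphic derivative `∂` -/
  del : Ω →ₗ[ℂ] Ω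
  /-- the anti-holomorphic derivative `∂̄` -/
  dbar : Ω →ₗ[ℂ] Ω
  del_mem : ∀ {a b : ℕ} {ω : Ω}, ω ∈ bi (a, b) → del ω ∈ bi (a + 1, b)
  dbar_mem : ∀ {a b : ℕ} {ω : Ω}, ω ∈ bi (a, b) → dbar ω ∈ bi (a, b + 1)
  d_eq : d = del + dbar

/-- A Kähler structure of total degree `2n`: a complex structure with a closed central real
`(1,1)`-form `κ` such that `L^{n-k} : Ωᵏ → Ω^{2n-k}` is an isomorphism for all `k < n`, where
`L ω = κ ∧ ω` is the Lefschetz operator. -/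
structure KahlerStructure (Ω : Type*) [Ring Ω] [Algebra ℂ Ω] (n : ℕ)
    extends ComplexStructure Ω where
  top_ne_bot : gr (2 * n) ≠ ⊥
  above_eq_bot : ∀ k : ℕ, 2 * n < k → gr k = ⊥
  /-- the Kähler form -/
  κ : Ω
  κ_mem : κ ∈ bi (1, 1)
  κ_central : ∀ ω : Ω, κ * ω = ω * κ
  κ_real : st κ = κ
  κ_closed : d κ = 0
  lefschetz : ∀ k : ℕ, k < n →
    Set.BijOn (fun ω : Ω => κ ^ (n - k) * ω) (gr k : Set Ω) (gr (2 * n - k) : Set Ω)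

section Calculus

variable {Ω : Type*} [Ring Ω] [Algebra ℂ Ω]

instance (C : DifferentialCalculus Ω) : GradedAlgebra C.gr := C.graded

instance (C : ComplexStructure Ω) : GradedAlgebra C.bi := C.bigraded

namespace DifferentialCalculus

/-- The algebra `B = Ω⁰`. -/
def base (C : DifferentialCalculus Ω) : Subalgebra ℂ Ω where
  carrier := C.gr 0
  mul_mem' := fun {a b} ha hb => by
    have := SetLike.GradedMul.mul_mem (A := C.gr) ha hb
    simpa using this
  add_mem' := fun ha hb => (C.gr 0).add_mem ha hb
  algebraMap_mem' := fun r => by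
    rw [Algebra.algebraMap_eq_smul_one]
    exact (C.gr 0).smul_mem r (SetLike.GradedOne.one_mem (A := C.gr))

theorem mem_base {C : DifferentialCalculus Ω} {ω : Ω} : ω ∈ C.base ↔ ω ∈ C.gr 0 := Iff.rfl

/-- The projection of `Ω` onto its degree zero part `B`. -/
def toBase (C : DifferentialCalculus Ω) : Ω →ₗ[ℂ] C.base where
  toFun ω := ⟨GradedAlgebra.proj C.gr 0 ω, by
    rw [mem_base, GradedAlgebra.proj_apply]; exact SetLike.coe_mem _⟩
  map_add' x y := by ext; simp
  map_smul' c x := by ext; simp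

/-- The sign operator `ω ↦ (-1)^{|ω|} ω`. -/
def sgn (C : DifferentialCalculus Ω) : Ω →ₗ[ℂ] Ω :=
  (DirectSum.toModule ℂ ℕ Ω fun k => (-1 : ℂ) ^ k • (C.gr k).subtype) ∘ₗ
    (DirectSum.decomposeLinearEquiv C.gr).toLinearMap

theorem sgn_of_mem (C : DifferentialCalculus Ω) {k : ℕ} {ω : Ω} (h : ω ∈ C.gr k) :
    C.sgn ω = (-1 : ℂ) ^ k • ω := by
  simp only [sgn, LinearMap.comp_apply, LinearEquiv.coe_coe, DirectSum.decomposeLinearEquiv_apply]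
  rw [DirectSum.decompose_of_mem C.gr h]
  erw [DirectSum.toModule_lof ℂ]
  simp

/-- Two linear maps agree if they agree on homogeneous elements. -/
theorem hom_ext (C : DifferentialCalculus Ω) {M : Type*} [AddCommMonoid M] [Module ℂ M]
    {f g : Ω →ₗ[ℂ] M} (h : ∀ (k : ℕ) (ω : Ω), ω ∈ C.gr k → f ω = g ω) : f = g :=
  DirectSum.decompose_lhom_ext C.gr fun k => by
    ext ⟨x, hx⟩
    exact h k x hx

theorem d_mul_base (C : DifferentialCalculus Ω) (ω : Ω) (b : C.base) :
    C.d (ω * b) = C.d ω * b + C.sgn ω * C.d b := by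
  have : C.d ∘ₗ LinearMap.mulRight ℂ (b : Ω) =
      LinearMap.mulRight ℂ (b : Ω) ∘ₗ C.d + LinearMap.mulRight ℂ (C.d b) ∘ₗ C.sgn := by
    refine C.hom_ext fun k ω hω => ?_
    simp [C.d_mul hω, C.sgn_of_mem hω]
  simpa using LinearMap.congr_fun this ω

theorem sgn_mul_base (C : DifferentialCalculus Ω) (ω : Ω) (b : C.base) :
    C.sgn (ω * b) = C.sgn ω * b := by
  have : C.sgn ∘ₗ LinearMap.mulRight ℂ (b : Ω) = LinearMap.mulRight ℂ (b : Ω) ∘ₗ C.sgn := by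
    refine C.hom_ext fun k ω hω => ?_
    have h : ω * b ∈ C.gr k := by
      simpa using SetLike.GradedMul.mul_mem (A := C.gr) hω (mem_base.1 b.2)
    simp [C.sgn_of_mem hω, C.sgn_of_mem h]
  simpa using LinearMap.congr_fun this ω

end DifferentialCalculus

namespace StarCalculus

/-- The `*`-map of the algebra `B`. -/
def baseStar (C : StarCalculus Ω) (b : C.base) : C.base := ⟨C.st b, C.st_mem b.2⟩

theorem st_mul_base (C : StarCalculus Ω) (ω : Ω) (b : C.base) :
    C.st (ω * b) = C.baseStar b * C.st ω := by
  induction ω using DirectSum.Decomposition.inductionOn C.gr with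
  | zero => simp
  | homogeneous x => simp [C.st_mul x.2 b.2, baseStar]
  | add x y hx hy => simp [add_mul, mul_add, hx, hy]

theorem st_one (C : StarCalculus Ω) : C.st 1 = 1 := by
  have h1 : (1 : Ω) ∈ C.gr 0 := SetLike.GradedOne.one_mem (A := C.gr)
  have := C.st_mul h1 (C.st_mem h1)
  simpa [C.st_st] using this.symm

/-- The cone `B_{≥ 0}` spanned over `ℝ_{>0}` by the elements `b^* b`. -/
def posCone (C : StarCalculus Ω) : AddSubmonoid C.base :=
  AddSubmonoid.closure {x | ∃ (r : ℝ) (b : C.base), 0 < r ∧ x = (r : ℂ) • (C.baseStar b * b)}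

/-- A state: a linear map `𝐟 : B → ℂ` with `𝐟 (b^* b) > 0` for all non-zero `b ∈ B`. -/
structure State (C : StarCalculus Ω) where
  toFun : C.base →ₗ[ℂ] ℂ
  pos : ∀ b : C.base, b ≠ 0 →
    (toFun (C.baseStar b * b)).im = 0 ∧ 0 < (toFun (C.baseStar b * b)).re

end StarCalculus

namespace ComplexStructure

theorem bi_le (C : ComplexStructure Ω) (p : ℕ × ℕ) : C.bi p ≤ C.gr (p.1 + p.2) := by
  rw [C.gr_eq]
  exact le_iSup₂_of_le p rfl le_rfl

theorem base_mem_bi (C : ComplexStructure Ω) (b : C.base) : (b : Ω) ∈ C.bi (0, 0) := by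
  have h : (b : Ω) ∈ C.gr 0 := b.2
  rw [C.gr_eq] at h
  have hle : (⨆ (p : ℕ × ℕ) (_ : p.1 + p.2 = 0), C.bi p) ≤ C.bi (0, 0) := by
    refine iSup₂_le fun p hp => ?_
    have : p = (0, 0) := by ext <;> simp <;> omega
    rw [this]
  exact hle h

theorem bi_mul_mem (C : ComplexStructure Ω) {p q : ℕ × ℕ} {x y : Ω} (hx : x ∈ C.bi p)
    (hy : y ∈ C.bi q) : x * y ∈ C.bi (p + q) :=
  SetLike.GradedMul.mul_mem (A := C.bi) hx hy

/-- Two linear maps agree if they agree on bihomogeneous elements. -/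
theorem bihom_ext (C : ComplexStructure Ω) {M : Type*} [AddCommMonoid M] [Module ℂ M]
    {f g : Ω →ₗ[ℂ] M} (h : ∀ (p : ℕ × ℕ) (ω : Ω), ω ∈ C.bi p → f ω = g ω) : f = g :=
  DirectSum.decompose_lhom_ext C.bi fun p => by
    ext ⟨x, hx⟩
    exact h p x hx

theorem dbar_mul_base (C : ComplexStructure Ω) (ω : Ω) (b : C.base) :
    C.dbar (ω * b) = C.dbar ω * b + C.sgn ω * C.dbar b := by
  have key : C.dbar ∘ₗ LinearMap.mulRight ℂ (b : Ω) =
      LinearMap.mulRight ℂ (b : Ω) ∘ₗ C.dbar + LinearMap.mulRight ℂ (C.dbar b) ∘ₗ C.sgn := by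
    refine C.bihom_ext fun ⟨i, j⟩ x hx => ?_
    have hb := C.base_mem_bi b
    have h := C.d_mul_base x b
    simp only [C.d_eq, LinearMap.add_apply] at h
    have hs : C.sgn x ∈ C.bi (i, j) := by
      rw [C.sgn_of_mem (C.bi_le _ hx)]; exact (C.bi _).smul_mem _ hx
    have hxb : x * b ∈ C.bi (i, j) := by simpa using C.bi_mul_mem hx hb
    have e1 : C.del (x * b) ∈ C.bi (i + 1, j) := C.del_mem hxb
    have e2 : C.dbar (x * b) ∈ C.bi (i, j + 1) := C.dbar_mem hxb
    have e3 : C.del x * b ∈ C.bi (i + 1, j) := by simpa using C.bi_mul_mem (C.del_mem hx) hb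
    have e4 : C.dbar x * b ∈ C.bi (i, j + 1) := by simpa using C.bi_mul_mem (C.dbar_mem hx) hb
    have e5 : C.sgn x * C.del b ∈ C.bi (i + 1, j) := by
      simpa using C.bi_mul_mem hs (C.del_mem hb)
    have e6 : C.sgn x * C.dbar b ∈ C.bi (i, j + 1) := by
      simpa using C.bi_mul_mem hs (C.dbar_mem hb)
    have hne : ((i + 1, j) : ℕ × ℕ) ≠ (i, j + 1) := by simp
    have h2 := congrArg (GradedAlgebra.proj C.bi (i, j + 1)) h
    simp only [mul_add, add_mul, map_add, GradedAlgebra.proj_apply] at h2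
    rw [DirectSum.decompose_of_mem_ne _ e1 hne, DirectSum.decompose_of_mem_same _ e2,
      DirectSum.decompose_of_mem_ne _ e3 hne, DirectSum.decompose_of_mem_same _ e4,
      DirectSum.decompose_of_mem_ne _ e5 hne, DirectSum.decompose_of_mem_same _ e6] at h2
    simpa using h2
  simpa using LinearMap.congr_fun key ω

end ComplexStructure

/-! ## The Hodge map -/

namespace KahlerStructure

variable {n : ℕ}

/-- The primitive forms of bidegree `p`, that is, of degree `k = p.1 + p.2`: the kernel of
`L^{n-k+1}` in `Ω^p` (and zero if `k > n`). -/
def primitive (K : KahlerStructure Ω n) (p : ℕ × ℕ) : Submodule ℂ Ω :=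
  K.bi p ⊓ LinearMap.ker (LinearMap.mulLeft ℂ (K.κ ^ (n + 1 - (p.1 + p.2))))

theorem mem_primitive {K : KahlerStructure Ω n} {p : ℕ × ℕ} {x : Ω} :
    x ∈ K.primitive p ↔ x ∈ K.bi p ∧ K.κ ^ (n + 1 - (p.1 + p.2)) * x = 0 := by
  simp [primitive]

/-- The defining property of the Hodge map `∗`:
`∗ (L^j α) = (-1)^{k(k+1)/2} i^{a-b} (j! / (n-j-k)!) L^{n-j-k} α` for every primitive form `α` of
bidegree `(a,b)`, `k = a + b`, and every `j ≤ n - k`. -/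
def IsHodgeMap (K : KahlerStructure Ω n) (s : Ω →ₗ[ℂ] Ω) : Prop :=
  ∀ (a b j : ℕ), j + (a + b) ≤ n → ∀ α ∈ K.primitive (a, b),
    s (K.κ ^ j * α) =
      ((-1 : ℂ) ^ ((a + b) * (a + b + 1) / 2) * Complex.I ^ ((a : ℤ) - (b : ℤ)) *
        ((j.factorial : ℂ) / ((n - j - (a + b)).factorial : ℂ))) •
          (K.κ ^ (n - j - (a + b)) * α)

theorem κ_pow_mem (K : KahlerStructure Ω n) (j : ℕ) : K.κ ^ j ∈ K.bi (j, j) := by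
  have := SetLike.pow_mem_graded (A := K.bi) j K.κ_mem
  simpa using this

theorem κ_pow_central (K : KahlerStructure Ω n) (j : ℕ) (ω : Ω) : K.κ ^ j * ω = ω * K.κ ^ j :=
  (Commute.pow_left (K.κ_central ω) j).eq

theorem κ_pow_mul_mem_bi (K : KahlerStructure Ω n) (j : ℕ) {p : ℕ × ℕ} {x : Ω}
    (hx : x ∈ K.bi p) : K.κ ^ j * x ∈ K.bi ((j, j) + p) :=
  K.bi_mul_mem (K.κ_pow_mem j) hx

theorem κ_pow_mul_mem_gr (K : KahlerStructure Ω n) (j : ℕ) {k : ℕ} {x : Ω}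
    (hx : x ∈ K.gr k) : K.κ ^ j * x ∈ K.gr (2 * j + k) := by
  have h := K.bi_le _ (K.κ_pow_mem j)
  have := SetLike.GradedMul.mul_mem (A := K.gr) h hx
  have e : 2 * j + k = (j, j).1 + (j, j).2 + k := by simp; omega
  rw [e]; exact this

theorem κ_pow_inj (K : KahlerStructure Ω n) {k : ℕ} (hk : k ≤ n) {x : Ω} (hx : x ∈ K.gr k)
    (h : K.κ ^ (n - k) * x = 0) : x = 0 := by
  rcases hk.lt_or_eq with hk | rfl
  · exact (K.lefschetz k hk).injOn hx (K.gr k).zero_mem (by simpa using h)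
  · simpa using h

/-- The graded piece of degree `m` of the sum of the images of primitive forms. -/
def lefschetzSpan (K : KahlerStructure Ω n) (m : ℕ) : Submodule ℂ Ω :=
  Submodule.span ℂ {y | ∃ (a b j : ℕ) (x : Ω), j + (a + b) ≤ n ∧ 2 * j + (a + b) = m ∧
    x ∈ K.primitive (a, b) ∧ y = K.κ ^ j * x}

/-- A form of degree `k ≤ n` killed by `L^{n-k+1}` is a sum of bihomogeneous such forms. -/
theorem mem_lefschetzSpan_of_primitive (K : KahlerStructure Ω n) {m : ℕ} (hm : m ≤ n) {x : Ω}
    (hx : x ∈ K.gr m) (h : K.κ ^ (n + 1 - m) * x = 0) : x ∈ K.lefschetzSpan m := by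
  classical
  rw [← DirectSum.sum_support_decompose K.bi x]
  refine Submodule.sum_mem _ fun p _ => ?_
  by_cases hp : p.1 + p.2 = m
  · refine Submodule.subset_span ⟨p.1, p.2, 0, _, by omega, by omega, ?_, (by simp; rfl)⟩
    refine mem_primitive.2 ⟨SetLike.coe_mem _, ?_⟩
    rw [hp, ← DirectSum.coe_decompose_mul_add_of_left_mem K.bi (K.κ_pow_mem _), h]
    simp
  · have : ((DirectSum.decompose K.bi x p : K.bi p) : Ω) = 0 := by
      rw [K.gr_eq] at hx
      have hle : (⨆ (q : ℕ × ℕ) (_ : q.1 + q.2 = m), K.bi q) ≤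
          LinearMap.ker (GradedAlgebra.proj K.bi p) := by
        refine iSup₂_le fun q hq y hy => ?_
        rw [LinearMap.mem_ker, GradedAlgebra.proj_apply]
        exact DirectSum.decompose_of_mem_ne _ hy (by rintro rfl; exact hp hq)
      simpa [GradedAlgebra.proj_apply] using hle hx
    rw [this]; exact Submodule.zero_mem _

theorem κ_mul_lefschetzSpan (K : KahlerStructure Ω n) (i m : ℕ) {x : Ω}
    (hx : x ∈ K.lefschetzSpan m) : K.κ ^ i * x ∈ K.lefschetzSpan (2 * i + m) := by
  have : K.lefschetzSpan m ≤
      (K.lefschetzSpan (2 * i + m)).comap (LinearMap.mulLeft ℂ (K.κ ^ i)) := by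
    refine Submodule.span_le.2 ?_
    rintro _ ⟨a, b, j, y, h1, h2, hy, rfl⟩
    simp only [Submodule.comap_coe, Set.mem_preimage, LinearMap.mulLeft_apply, SetLike.mem_coe]
    rw [← mul_assoc, ← pow_add]
    by_cases h : i + j + (a + b) ≤ n
    · exact Submodule.subset_span ⟨a, b, i + j, y, h, by omega, hy, rfl⟩
    · have e : i + j = (i + j - (n + 1 - (a + b))) + (n + 1 - (a + b)) := by omega
      rw [e, pow_add, mul_assoc, (mem_primitive.1 hy).2, mul_zero]
      exact Submodule.zero_mem _
  exact this hx

/-- Lefschetz decomposition: forms are sums of powers of `κ` times primitive forms. -/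
theorem gr_le_lefschetzSpan (K : KahlerStructure Ω n) (m : ℕ) : K.gr m ≤ K.lefschetzSpan m := by
  have low : ∀ m, m ≤ n → K.gr m ≤ K.lefschetzSpan m := by
    intro m
    induction m using Nat.strong_induction_on with
    | _ m ih =>
      intro hm x hx
      by_cases h2 : 2 ≤ m
      · have hmem : K.κ ^ (n + 1 - m) * x ∈ K.gr (2 * n - (m - 2)) := by
          have := K.κ_pow_mul_mem_gr (n + 1 - m) hx
          convert this using 2; omega
        obtain ⟨y, hy, hyx⟩ := (K.lefschetz (m - 2) (by omega)).surjOn hmem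
        have e : n - (m - 2) = (n + 1 - m) + 1 := by omega
        simp only [e, pow_add, pow_one, mul_assoc] at hyx
        have hκy : K.κ * y ∈ K.gr m := by
          have := K.κ_pow_mul_mem_gr 1 hy
          rw [pow_one] at this
          convert this using 2; omega
        have hp : x - K.κ * y ∈ K.lefschetzSpan m :=
          K.mem_lefschetzSpan_of_primitive hm ((K.gr m).sub_mem hx hκy)
            (by rw [mul_sub, hyx, sub_self])
        have hq : K.κ * y ∈ K.lefschetzSpan m := by
          have := K.κ_mul_lefschetzSpan 1 _ (ih (m - 2) (by omega) (by omega) hy)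
          rw [pow_one] at this
          convert this using 2; omega
        simpa using Submodule.add_mem _ hp hq
      · refine K.mem_lefschetzSpan_of_primitive hm hx ?_
        have := K.κ_pow_mul_mem_gr (n + 1 - m) hx
        rw [K.above_eq_bot _ (by omega)] at this
        simpa using this
  by_cases hm : m ≤ n
  · exact low m hm
  · by_cases hm2 : m ≤ 2 * n
    · intro x hx
      have e : m = 2 * n - (2 * n - m) := by omega
      rw [e] at hx
      obtain ⟨y, hy, rfl⟩ := (K.lefschetz (2 * n - m) (by omega)).surjOn hx
      have := K.κ_mul_lefschetzSpan (n - (2 * n - m)) _ (low _ (by omega) hy)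
      convert this using 2; omega
    · rw [K.above_eq_bot m (by omega)]; exact bot_le

/-- Linear maps that agree on powers of `κ` times primitive forms are equal. -/
theorem lefschetz_ext (K : KahlerStructure Ω n) {M : Type*} [AddCommMonoid M] [Module ℂ M]
    {f g : Ω →ₗ[ℂ] M} (h : ∀ (a b j : ℕ) (x : Ω), j + (a + b) ≤ n → x ∈ K.primitive (a, b) →
      f (K.κ ^ j * x) = g (K.κ ^ j * x)) : f = g := by
  refine K.hom_ext fun k ω hω => ?_
  have : K.lefschetzSpan k ≤ LinearMap.eqLocus f g := by
    refine Submodule.span_le.2 ?_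
    rintro _ ⟨a, b, j, x, h1, -, hx, rfl⟩
    exact h a b j x h1 hx
  exact this (K.gr_le_lefschetzSpan k hω)

/-- The summand of the Lefschetz decomposition indexed by `(j, (a, b))`. -/
def summand (K : KahlerStructure Ω n) (t : ℕ × (ℕ × ℕ)) : Submodule ℂ Ω :=
  if t.1 + (t.2.1 + t.2.2) ≤ n then K.primitive t.2 else ⊥

theorem mem_summand (K : KahlerStructure Ω n) {t : ℕ × (ℕ × ℕ)} {y : Ω} (hy : y ∈ K.summand t) :
    (t.1 + (t.2.1 + t.2.2) ≤ n ∧ y ∈ K.primitive t.2) ∨ y = 0 := by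
  by_cases h : t.1 + (t.2.1 + t.2.2) ≤ n
  · rw [summand, if_pos h] at hy; exact Or.inl ⟨h, hy⟩
  · rw [summand, if_neg h] at hy; exact Or.inr (by simpa using hy)

/-- The sum map of the Lefschetz decomposition. -/
def sumMap (K : KahlerStructure Ω n) : (DirectSum (ℕ × (ℕ × ℕ)) fun t => K.summand t) →ₗ[ℂ] Ω :=
  DirectSum.toModule ℂ _ Ω fun t => LinearMap.mulLeft ℂ (K.κ ^ t.1) ∘ₗ (K.summand t).subtype

theorem sumMap_lof (K : KahlerStructure Ω n) (t : ℕ × (ℕ × ℕ)) (x : K.summand t) :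
    K.sumMap (DirectSum.lof ℂ _ (fun t => K.summand t) t x) = K.κ ^ t.1 * x := by
  simp [sumMap]

theorem sumMap_surjective (K : KahlerStructure Ω n) : Function.Surjective K.sumMap := by
  rw [← LinearMap.range_eq_top, eq_top_iff]
  intro x _
  induction x using DirectSum.Decomposition.inductionOn K.gr with
  | zero => exact Submodule.zero_mem _
  | add x y hx hy => exact Submodule.add_mem _ (hx trivial) (hy trivial)
  | @homogeneous m x =>
    have : K.lefschetzSpan m ≤ LinearMap.range K.sumMap := by
      refine Submodule.span_le.2 ?_
      rintro _ ⟨a, b, j, y, h1, -, hy, rfl⟩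
      have hy' : y ∈ K.summand (j, (a, b)) := by
        rw [summand, if_pos h1]; exact hy
      exact ⟨DirectSum.lof ℂ _ (fun t => K.summand t) (j, (a, b)) ⟨y, hy'⟩, K.sumMap_lof _ _⟩
    exact this (K.gr_le_lefschetzSpan m x.2)

theorem eq_zero_of_sumMap_eq_zero (K : KahlerStructure Ω n)
    (x : DirectSum (ℕ × (ℕ × ℕ)) fun t => K.summand t) (hx : K.sumMap x = 0) : x = 0 := by
  classical
  by_contra hne
  have hsupp : (DFinsupp.support x).Nonempty := by
    rw [Finset.nonempty_iff_ne_empty]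
    intro h
    exact hne (DFinsupp.support_eq_empty.1 h)
  obtain ⟨t, ht, hmax⟩ := (DFinsupp.support x).exists_max_image (fun t => t.1) hsupp
  have hxt : x t ≠ 0 := DFinsupp.mem_support_iff.1 ht
  have prim : ∀ s ∈ DFinsupp.support x, s.1 + (s.2.1 + s.2.2) ≤ n ∧ (x s : Ω) ∈ K.primitive s.2 := by
    intro s hs
    refine (K.mem_summand (x s).2).resolve_right fun h0 => ?_
    exact DFinsupp.mem_support_iff.1 hs (Subtype.ext h0)
  obtain ⟨htn, htp⟩ := prim t ht
  set N := n - (t.1 + (t.2.1 + t.2.2)) with hN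
  let G : Ω →ₗ[ℂ] Ω := LinearMap.mulLeft ℂ (K.κ ^ N) ∘ₗ
    GradedAlgebra.proj K.bi ((t.1, t.1) + t.2)
  have hsum : K.sumMap x = ∑ s ∈ DFinsupp.support x, K.κ ^ s.1 * (x s : Ω) := by
    conv_lhs => rw [← DirectSum.sum_support_of x]
    rw [map_sum]
    exact Finset.sum_congr rfl fun s _ => K.sumMap_lof s (x s)
  have hG : G (K.sumMap x) = K.κ ^ N * (K.κ ^ t.1 * (x t : Ω)) := by
    rw [hsum, map_sum, Finset.sum_eq_single t]
    · simp only [G, LinearMap.comp_apply, LinearMap.mulLeft_apply, GradedAlgebra.proj_apply]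
      rw [DirectSum.decompose_of_mem_same _ (K.κ_pow_mul_mem_bi _ (mem_primitive.1 htp).1)]
    · intro s hs hst
      obtain ⟨hsn, hsp⟩ := prim s hs
      have hsmem := K.κ_pow_mul_mem_bi s.1 (mem_primitive.1 hsp).1
      simp only [G, LinearMap.comp_apply, LinearMap.mulLeft_apply, GradedAlgebra.proj_apply]
      by_cases hdeg : (s.1, s.1) + s.2 = (t.1, t.1) + t.2
      · rw [← hdeg, DirectSum.decompose_of_mem_same _ hsmem]
        have h1 := congrArg Prod.fst hdeg
        have h2 := congrArg Prod.snd hdeg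
        simp only [Prod.fst_add, Prod.snd_add] at h1 h2
        have hle := hmax s hs
        have hlt : s.1 < t.1 := by
          refine lt_of_le_of_ne hle fun h => hst ?_
          refine Prod.ext h (Prod.ext ?_ ?_) <;> omega
        rw [← mul_assoc, ← pow_add]
        have e : N + s.1 = (N + s.1 - (n + 1 - (s.2.1 + s.2.2))) + (n + 1 - (s.2.1 + s.2.2)) := by
          omega
        rw [e, pow_add, mul_assoc, (mem_primitive.1 hsp).2, mul_zero]
      · rw [DirectSum.decompose_of_mem_ne _ hsmem hdeg, mul_zero]
    · intro h; exact absurd ht h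
  rw [hx, map_zero, ← mul_assoc, ← pow_add] at hG
  have e : N + t.1 = n - (t.2.1 + t.2.2) := by omega
  rw [e] at hG
  have := K.κ_pow_inj (by omega) (K.bi_le _ (mem_primitive.1 htp).1) hG.symm
  exact hxt (Subtype.ext this)

theorem sumMap_injective (K : KahlerStructure Ω n) : Function.Injective K.sumMap := by
  intro x y hxy
  have h := K.eq_zero_of_sumMap_eq_zero (x + (-1 : ℂ) • y) (by
    rw [map_add, map_smul, hxy, neg_one_smul, add_neg_cancel])
  refine DFinsupp.ext fun t => ?_
  have ht : (x t : Ω) + (-1 : ℂ) • (y t : Ω) = 0 :=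
    congrArg (fun z : DirectSum (ℕ × (ℕ × ℕ)) fun t => K.summand t => (z t : Ω)) h
  rw [neg_one_smul] at ht
  exact Subtype.ext (add_neg_eq_zero.1 ht)

theorem exists_isHodgeMap (K : KahlerStructure Ω n) : ∃ s : Ω →ₗ[ℂ] Ω, K.IsHodgeMap s := by
  let e := LinearEquiv.ofBijective K.sumMap ⟨K.sumMap_injective, K.sumMap_surjective⟩
  let Ψ : (DirectSum (ℕ × (ℕ × ℕ)) fun t => K.summand t) →ₗ[ℂ] Ω :=
    DirectSum.toModule ℂ _ Ω fun t =>
      ((-1 : ℂ) ^ ((t.2.1 + t.2.2) * (t.2.1 + t.2.2 + 1) / 2) *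
        Complex.I ^ ((t.2.1 : ℤ) - (t.2.2 : ℤ)) *
        ((t.1.factorial : ℂ) / ((n - t.1 - (t.2.1 + t.2.2)).factorial : ℂ))) •
      (LinearMap.mulLeft ℂ (K.κ ^ (n - t.1 - (t.2.1 + t.2.2))) ∘ₗ (K.summand t).subtype)
  refine ⟨Ψ ∘ₗ e.symm.toLinearMap, fun a b j hj α hα => ?_⟩
  have hα' : α ∈ K.summand (j, (a, b)) := by
    rw [summand, if_pos hj]; exact hα
  have he : e.symm (K.κ ^ j * α) =
      DirectSum.lof ℂ _ (fun t => K.summand t) (j, (a, b)) ⟨α, hα'⟩ := by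
    rw [LinearEquiv.symm_apply_eq]
    exact (K.sumMap_lof (j, (a, b)) ⟨α, hα'⟩).symm
  simp only [LinearMap.comp_apply, LinearEquiv.coe_coe, he, Ψ, DirectSum.toModule_lof]
  simp

theorem isHodgeMap_unique (K : KahlerStructure Ω n) {s s' : Ω →ₗ[ℂ] Ω} (h : K.IsHodgeMap s)
    (h' : K.IsHodgeMap s') : s = s' :=
  K.lefschetz_ext fun a b j x hj hx => by rw [h a b j hj x hx, h' a b j hj x hx]

/-- The Hodge map `∗` of a Kähler structure. -/
def hodge (K : KahlerStructure Ω n) : Ω →ₗ[ℂ] Ω := K.exists_isHodgeMap.choose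

theorem hodge_spec (K : KahlerStructure Ω n) : K.IsHodgeMap K.hodge :=
  K.exists_isHodgeMap.choose_spec

theorem base_mul_primitive (K : KahlerStructure Ω n) (b : K.base) {p : ℕ × ℕ} {x : Ω}
    (hx : x ∈ K.primitive p) : (b : Ω) * x ∈ K.primitive p := by
  rw [mem_primitive] at hx ⊢
  have h := K.bi_mul_mem (K.base_mem_bi b) hx.1
  rw [show ((0, 0) : ℕ × ℕ) + p = p from zero_add p] at h
  refine ⟨h, ?_⟩
  rw [← mul_assoc, K.κ_pow_central, mul_assoc, hx.2, mul_zero]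

/-- The Hodge map is left `B`-linear. -/
theorem hodge_base_mul (K : KahlerStructure Ω n) (b : K.base) (ω : Ω) :
    K.hodge (b * ω) = b * K.hodge ω := by
  have : K.hodge ∘ₗ LinearMap.mulLeft ℂ (b : Ω) = LinearMap.mulLeft ℂ (b : Ω) ∘ₗ K.hodge := by
    refine K.lefschetz_ext fun a c j x hj hx => ?_
    simp only [LinearMap.comp_apply, LinearMap.mulLeft_apply]
    rw [← mul_assoc, ← K.κ_pow_central, mul_assoc, K.hodge_spec a c j hj _ (K.base_mul_primitive b hx),
      K.hodge_spec a c j hj x hx, mul_smul_comm, ← mul_assoc, ← mul_assoc, K.κ_pow_central]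
  simpa using LinearMap.congr_fun this ω

theorem hodge_mem (K : KahlerStructure Ω n) {k : ℕ} {ω : Ω} (hω : ω ∈ K.gr k) :
    K.hodge ω ∈ K.gr (2 * n - k) := by
  have : K.lefschetzSpan k ≤ (K.gr (2 * n - k)).comap K.hodge := by
    refine Submodule.span_le.2 ?_
    rintro _ ⟨a, b, j, x, h1, rfl, hx, rfl⟩
    simp only [Submodule.comap_coe, Set.mem_preimage, SetLike.mem_coe]
    rw [K.hodge_spec a b j h1 x hx]
    refine Submodule.smul_mem _ _ ?_
    have := K.κ_pow_mul_mem_gr (n - j - (a + b)) (K.bi_le _ (mem_primitive.1 hx).1)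
    convert this using 2; simp only; omega
  exact this (K.gr_le_lefschetzSpan k hω)

/-- The metric of a Kähler structure, linear in `ω` (second argument here) and conjugate linear in
`ν` (first argument here): `K.metric ν ω = g(ω, ν)` is the degree zero part of `∗(ω ∧ ∗(ν^*))`.
See `metric_of_mem` and `metric_of_ne`. -/
def metric (K : KahlerStructure Ω n) : Ω →ₛₗ[starRingEnd ℂ] Ω →ₗ[ℂ] K.base where
  toFun ν := K.toBase ∘ₗ K.hodge ∘ₗ LinearMap.mulRight ℂ (K.hodge (K.st ν))
  map_add' x y := by ext; simp [mul_add]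
  map_smul' c x := by ext; simp

theorem metric_of_mem (K : KahlerStructure Ω n) {k : ℕ} {ω ν : Ω} (hω : ω ∈ K.gr k)
    (hν : ν ∈ K.gr k) : (K.metric ν ω : Ω) = K.hodge (ω * K.hodge (K.st ν)) := by
  have h1 : ω * K.hodge (K.st ν) ∈ K.gr (k + (2 * n - k)) :=
    SetLike.GradedMul.mul_mem (A := K.gr) hω (K.hodge_mem (K.st_mem hν))
  by_cases hk : k ≤ 2 * n
  · have h2 := K.hodge_mem h1
    have e : 2 * n - (k + (2 * n - k)) = 0 := by omega
    rw [e] at h2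
    simp [metric, DifferentialCalculus.toBase, GradedAlgebra.proj_apply,
      DirectSum.decompose_of_mem_same _ h2]
  · have : ω = 0 := by
      rw [K.above_eq_bot k (by omega)] at hω; simpa using hω
    simp [this]

theorem metric_of_ne (K : KahlerStructure Ω n) {k l : ℕ} (hkl : k ≠ l) {ω ν : Ω}
    (hω : ω ∈ K.gr k) (hν : ν ∈ K.gr l) : K.metric ν ω = 0 := by
  have h1 : ω * K.hodge (K.st ν) ∈ K.gr (k + (2 * n - l)) :=
    SetLike.GradedMul.mul_mem (A := K.gr) hω (K.hodge_mem (K.st_mem hν))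
  by_cases hl : l ≤ 2 * n
  · by_cases hk : l < k
    · rw [K.above_eq_bot _ (by omega), Submodule.mem_bot] at h1
      ext
      simp [metric, h1]
    · have h2 := K.hodge_mem h1
      ext
      simp only [metric, DifferentialCalculus.toBase, GradedAlgebra.proj_apply]
      exact DirectSum.decompose_of_mem_ne _ h2 (by omega)
  · have : ν = 0 := by
      rw [K.above_eq_bot l (by omega)] at hν; simpa using hν
    simp [this]

theorem metric_mul_base (K : KahlerStructure Ω n) (ω ν : Ω) (b : K.base) :
    K.metric (ν * b) ω = K.metric ν (ω * K.baseStar b) := by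
  simp only [metric, LinearMap.coe_mk, AddHom.coe_mk, LinearMap.comp_apply,
    LinearMap.mulRight_apply]
  rw [K.st_mul_base, K.hodge_base_mul, mul_assoc]

/-- The integral `∫ = 𝐟 ∘ ∗ : Ω^{2n} → ℂ` of a state (extended by zero to the other degrees). -/
def integral (K : KahlerStructure Ω n) (φ : K.State) : Ω →ₗ[ℂ] ℂ :=
  φ.toFun ∘ₗ K.toBase ∘ₗ K.hodge

/-- The integral is closed: `∫ dω = 0` for all `ω ∈ Ω^{2n-1}`. -/
def ClosedIntegral (K : KahlerStructure Ω n) (φ : K.State) : Prop :=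
  ∀ (k : ℕ) (ω : Ω), k + 1 = 2 * n → ω ∈ K.gr k → K.integral φ (K.d ω) = 0

end KahlerStructure

end Calculus

/-! ## The tensor product `Ω ⊗_B F` over a noncommutative algebra `B` -/

section Tensor

variable {Ω : Type*} [Ring Ω] [Algebra ℂ Ω] (B : Subalgebra ℂ Ω)
  (F : Type*) [AddCommGroup F] [Module ℂ F] [Module B F]

/-- The relations `ωb ⊗ f = ω ⊗ bf`. -/
def balanced : Submodule ℂ (Ω ⊗[ℂ] F) :=
  Submodule.span ℂ {t | ∃ (ω : Ω) (b : B) (f : F), t = (ω * b) ⊗ₜ[ℂ] f - ω ⊗ₜ[ℂ] (b • f)}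

/-- The tensor product `Ω ⊗_B F` of the right `B`-module `Ω` and the left `B`-module `F`. -/
abbrev Forms : Type _ := (Ω ⊗[ℂ] F) ⧸ balanced B F

variable {F}

/-- The element `ω ⊗ f` of `Ω ⊗_B F`. -/
def tmul (ω : Ω) (f : F) : Forms B F := (balanced B F).mkQ (ω ⊗ₜ[ℂ] f)

variable {B}

theorem tmul_base (ω : Ω) (b : B) (f : F) : tmul B (ω * b) f = tmul B ω (b • f) := by
  have : (ω * b) ⊗ₜ[ℂ] f - ω ⊗ₜ[ℂ] (b • f) ∈ balanced B F :=
    Submodule.subset_span ⟨ω, b, f, rfl⟩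
  exact (Submodule.Quotient.eq _).2 this

theorem tmul_add_left (ω η : Ω) (f : F) : tmul B (ω + η) f = tmul B ω f + tmul B η f := by
  simp [tmul, TensorProduct.add_tmul]

theorem tmul_add_right (ω : Ω) (f g : F) : tmul B ω (f + g) = tmul B ω f + tmul B ω g := by
  simp [tmul, TensorProduct.tmul_add]

theorem tmul_smul_left (c : ℂ) (ω : Ω) (f : F) : tmul B (c • ω) f = c • tmul B ω f := by
  simp only [tmul, ← TensorProduct.smul_tmul', map_smul]

theorem tmul_smul_right (c : ℂ) (ω : Ω) (f : F) : tmul B ω (c • f) = c • tmul B ω f := by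
  simp only [tmul, TensorProduct.tmul_smul, map_smul]

/-- The universal property of `Ω ⊗_B F`, for maps semilinear over an endomorphism of `ℂ`. -/
def formsLift {σ : ℂ →+* ℂ} {M : Type*} [AddCommGroup M] [Module ℂ M]
    (u : Ω →ₛₗ[σ] F →ₛₗ[σ] M) (hu : ∀ (ω : Ω) (b : B) (f : F), u (ω * b) f = u ω (b • f)) :
    Forms B F →ₛₗ[σ] M :=
  (balanced B F).liftQ (TensorProduct.lift u) <| by
    refine Submodule.span_le.2 ?_
    rintro _ ⟨ω, b, f, rfl⟩
    simp [hu]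

@[simp]
theorem formsLift_tmul {σ : ℂ →+* ℂ} {M : Type*} [AddCommGroup M] [Module ℂ M]
    (u : Ω →ₛₗ[σ] F →ₛₗ[σ] M) (hu : ∀ (ω : Ω) (b : B) (f : F), u (ω * b) f = u ω (b • f))
    (ω : Ω) (f : F) : formsLift u hu (tmul B ω f) = u ω f := rfl

theorem forms_ext {σ : ℂ →+* ℂ} {M : Type*} [AddCommGroup M] [Module ℂ M]
    {u v : Forms B F →ₛₗ[σ] M} (h : ∀ (ω : Ω) (f : F), u (tmul B ω f) = v (tmul B ω f)) :
    u = v := by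
  refine LinearMap.ext fun x => ?_
  obtain ⟨y, rfl⟩ := (balanced B F).mkQ_surjective x
  induction y with
  | zero => simp
  | tmul ω f => exact h ω f
  | add x y hx hy => rw [map_add, map_add, map_add, hx, hy]

/-- The left action of `Ω` on `Ω ⊗_B F`: `wedge ω (η ⊗ f) = (ω ∧ η) ⊗ f`. -/
def wedge : Ω →ₗ[ℂ] Forms B F →ₗ[ℂ] Forms B F :=
  LinearMap.mk₂ ℂ
    (fun ω => formsLift (LinearMap.mk₂ ℂ (fun η f => tmul B (ω * η) f)
      (fun η η' f => by rw [mul_add, tmul_add_left])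
      (fun c η f => by rw [mul_smul_comm, tmul_smul_left])
      (fun η f f' => tmul_add_right _ _ _)
      (fun c η f => tmul_smul_right _ _ _))
      (fun η b f => by simp [← mul_assoc, tmul_base]))
    (fun ω ω' x => by
      rw [← LinearMap.add_apply]
      refine LinearMap.congr_fun (forms_ext fun η f => ?_) x
      change tmul B ((ω + ω') * η) f = tmul B (ω * η) f + tmul B (ω' * η) f
      rw [add_mul, tmul_add_left])
    (fun c ω x => by
      rw [← LinearMap.smul_apply]
      refine LinearMap.congr_fun (forms_ext fun η f => ?_) x
      change tmul B ((c • ω) * η) f = c • tmul B (ω * η) f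
      rw [smul_mul_assoc, tmul_smul_left])
    (fun ω x y => map_add _ _ _)
    (fun c ω x => map_smul _ _ _)

@[simp]
theorem wedge_tmul (ω η : Ω) (f : F) : wedge ω (tmul B η f) = tmul B (ω * η) f := rfl

theorem wedge_mul (ω η : Ω) (x : Forms B F) : wedge (ω * η) x = wedge ω (wedge η x) := by
  rw [← LinearMap.comp_apply]
  exact LinearMap.congr_fun (forms_ext fun ξ f => by simp [mul_assoc]) x

/-- For a subspace `S ⊆ Ω` (such as `Ωᵏ` or `Ω^{(a,b)}`), the subspace `S ⊗_B F` of `Ω ⊗_B F`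
spanned by the elements `ω ⊗ f` with `ω ∈ S`. -/
def formsIn (F : Type*) [AddCommGroup F] [Module ℂ F] [Module B F] (S : Submodule ℂ Ω) :
    Submodule ℂ (Forms B F) :=
  Submodule.span ℂ {x | ∃ ω ∈ S, ∃ f : F, x = tmul B ω f}

end Tensor

/-! ## Connections, holomorphic modules and Hermitian modules -/

section Modules

variable {Ω : Type*} [Ring Ω] [Algebra ℂ Ω]

/-- The extension of `∇ : F → Ω ⊗_B F` to `Ω ⊗_B F`,
`∇ (ω ⊗ f) = δω ⊗ f + (-1)^{|ω|} ω ∧ ∇ f`, for a derivation `δ` of `Ω` of degree one with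
`∇ (bf) = δb ⊗ f + b ∇ f`. -/
def extendConn (C : DifferentialCalculus Ω) {F : Type*} [AddCommGroup F] [Module ℂ F]
    [Module C.base F] (δ : Ω →ₗ[ℂ] Ω)
    (hδ : ∀ (ω : Ω) (b : C.base), δ (ω * b) = δ ω * b + C.sgn ω * δ b)
    (D : F →ₗ[ℂ] Forms C.base F)
    (hD : ∀ (b : C.base) (f : F), D (b • f) = tmul C.base (δ b) f + wedge (b : Ω) (D f)) :
    Forms C.base F →ₗ[ℂ] Forms C.base F :=
  formsLift (LinearMap.mk₂ ℂ (fun ω f => tmul C.base (δ ω) f + wedge (C.sgn ω) (D f))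
    (fun ω η f => by simp only [map_add, tmul_add_left, LinearMap.add_apply]; abel)
    (fun c ω f => by simp only [map_smul, tmul_smul_left, LinearMap.smul_apply, smul_add])
    (fun ω f g => by simp only [map_add, tmul_add_right]; abel)
    (fun c ω f => by simp only [map_smul, tmul_smul_right, smul_add]))
    (fun ω b f => by
      simp only [LinearMap.mk₂_apply, hδ, hD, tmul_add_left, map_add, wedge_tmul, C.sgn_mul_base,
        wedge_mul, tmul_base]
      abel)

/-- A left connection `∇ : F → Ω¹ ⊗_B F`. -/
structure Connection (C : DifferentialCalculus Ω) (F : Type*) [AddCommGroup F] [Module ℂ F]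
    [Module C.base F] where
  toFun : F →ₗ[ℂ] Forms C.base F
  mem : ∀ f : F, toFun f ∈ formsIn F (C.gr 1)
  leibniz : ∀ (b : C.base) (f : F),
    toFun (b • f) = tmul C.base (C.d b) f + wedge (b : Ω) (toFun f)

/-- The extension of a connection to `∇ : Ω ⊗_B F → Ω ⊗_B F`. -/
def Connection.extend {C : DifferentialCalculus Ω} {F : Type*} [AddCommGroup F] [Module ℂ F]
    [Module C.base F] (N : Connection C F) : Forms C.base F →ₗ[ℂ] Forms C.base F :=
  extendConn C C.d C.d_mul_base N.toFun N.leibniz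

/-- The curvature `∇² : F → Ω² ⊗_B F` of a connection. -/
def Connection.curvature {C : DifferentialCalculus Ω} {F : Type*} [AddCommGroup F] [Module ℂ F]
    [Module C.base F] (N : Connection C F) : F →ₗ[ℂ] Forms C.base F :=
  N.extend ∘ₗ N.toFun

/-- A `(0,1)`-connection `∂̄_F : F → Ω^{(0,1)} ⊗_B F`. -/
structure ZeroOneConnection (C : ComplexStructure Ω) (F : Type*) [AddCommGroup F] [Module ℂ F]
    [Module C.base F] where
  toFun : F →ₗ[ℂ] Forms C.base F
  mem : ∀ f : F, toFun f ∈ formsIn F (C.bi (0, 1))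
  leibniz : ∀ (b : C.base) (f : F),
    toFun (b • f) = tmul C.base (C.dbar b) f + wedge (b : Ω) (toFun f)

/-- The extension of a `(0,1)`-connection to `∂̄_F : Ω ⊗_B F → Ω ⊗_B F`,
`∂̄_F (ω ⊗ f) = ∂̄ω ⊗ f + (-1)^{|ω|} ω ∧ ∂̄_F f`. -/
def ZeroOneConnection.extend {C : ComplexStructure Ω} {F : Type*} [AddCommGroup F] [Module ℂ F]
    [Module C.base F] (N : ZeroOneConnection C F) : Forms C.base F →ₗ[ℂ] Forms C.base F :=
  extendConn C.toDifferentialCalculus C.dbar C.dbar_mul_base N.toFun N.leibniz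

/-- A holomorphic structure on `F`: a flat `(0,1)`-connection. -/
structure HolomorphicStructure (C : ComplexStructure Ω) (F : Type*) [AddCommGroup F] [Module ℂ F]
    [Module C.base F] extends ZeroOneConnection C F where
  flat : ∀ f : F, toZeroOneConnection.extend (toFun f) = 0

/-- An Hermitian structure on a left `B`-module `F`: an isomorphism `f̄ ↦ h f` of right `B`-modules
from the conjugate module `F̄` (where `f̄ b` is the conjugate of `b^* f`) to the dual `_B Hom (F, B)`
(where `(φ b)(f) = φ(f) b`), such that the sesquilinear pairing `h_F(f, k) = h k f` is
conjugate symmetric and positive definite. -/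
structure HermitianForm (C : StarCalculus Ω) (F : Type*) [AddCommGroup F] [Module C.base F] where
  h : F → (F →ₗ[C.base] C.base)
  h_add : ∀ k k' : F, h (k + k') = h k + h k'
  h_smul : ∀ (b : C.base) (k f : F), h (b • k) f = h k f * C.baseStar b
  bijective : Function.Bijective h
  symm : ∀ f k : F, h k f = C.baseStar (h f k)
  pos : ∀ f : F, f ≠ 0 → h f f ∈ C.posCone ∧ h f f ≠ 0

namespace HermitianForm

variable {C : StarCalculus Ω} {F : Type*} [AddCommGroup F] [Module ℂ F] [Module C.base F]
  [IsScalarTower ℂ C.base F]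

theorem h_smul_complex (H : HermitianForm C F) (c : ℂ) (k f : F) :
    H.h (c • k) f = starRingEnd ℂ c • H.h k f := by
  have e : c • k = (c • (1 : C.base)) • k := by rw [smul_assoc, one_smul]
  rw [e, H.h_smul]
  have : C.baseStar (c • (1 : C.base)) = starRingEnd ℂ c • (1 : C.base) := by
    ext
    simp [StarCalculus.baseStar, C.st_one]
  rw [this, mul_smul_comm, mul_one]

theorem h_apply_smul (H : HermitianForm C F) (c : ℂ) (k f : F) :
    H.h k (c • f) = c • H.h k f := by
  have e : c • f = (c • (1 : C.base)) • f := by rw [smul_assoc, one_smul]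
  rw [e, map_smul, smul_assoc, one_smul]

/-- The contraction `ω ⊗ f ↦ ω h_F(f, k)`, conjugate linear in `k`. -/
def contract (H : HermitianForm C F) : F →ₛₗ[starRingEnd ℂ] Forms C.base F →ₗ[ℂ] Ω :=
  LinearMap.mk₂'ₛₗ (starRingEnd ℂ) (RingHom.id ℂ)
    (fun k => formsLift (LinearMap.mk₂ ℂ (fun ω f => ω * (H.h k f : Ω))
      (fun ω η f => add_mul _ _ _)
      (fun c ω f => smul_mul_assoc _ _ _)
      (fun ω f g => by simp [mul_add])
      (fun c ω f => by simp [H.h_apply_smul]))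
      (fun ω b f => by simp [mul_assoc]))
    (fun k k' x => by
      rw [← LinearMap.add_apply]
      refine LinearMap.congr_fun (forms_ext fun η f => ?_) x
      simp [H.h_add, mul_add])
    (fun c k x => by
      rw [← LinearMap.smul_apply]
      refine LinearMap.congr_fun (forms_ext fun η f => ?_) x
      simp [H.h_smul_complex])
    (fun k x y => map_add _ _ _)
    (fun c k x => map_smul _ _ _)

@[simp]
theorem contract_tmul (H : HermitianForm C F) (k : F) (ω : Ω) (f : F) :
    H.contract k (tmul C.base ω f) = ω * (H.h k f : Ω) := rfl

theorem contract_smul (H : HermitianForm C F) (b : C.base) (k : F) (x : Forms C.base F) :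
    H.contract (b • k) x = H.contract k x * C.baseStar b := by
  have : H.contract (b • k) = LinearMap.mulRight ℂ (C.baseStar b : Ω) ∘ₗ H.contract k :=
    forms_ext fun η f => by simp [H.h_smul, mul_assoc]
  rw [this]; rfl

/-- The twist by `h_F` of a sesquilinear map `P` on `Ω` (conjugate linear argument first):
`(ω ⊗ f, ν ⊗ k) ↦ P(ω h_F(f, k), ν)`. Here too the conjugate linear argument comes first. -/
def twist (H : HermitianForm C F) {X : Type*} [AddCommGroup X] [Module ℂ X]
    (P : Ω →ₛₗ[starRingEnd ℂ] Ω →ₗ[ℂ] X)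
    (hP : ∀ (ω ν : Ω) (b : C.base), P (ν * b) ω = P ν (ω * C.baseStar b)) :
    Forms C.base F →ₛₗ[starRingEnd ℂ] Forms C.base F →ₗ[ℂ] X :=
  formsLift (LinearMap.mk₂'ₛₗ (starRingEnd ℂ) (starRingEnd ℂ)
    (fun ν k => P ν ∘ₗ H.contract k)
    (fun ν ν' k => LinearMap.ext fun x => by simp)
    (fun c ν k => LinearMap.ext fun x => by simp)
    (fun ν k k' => LinearMap.ext fun x => by simp)
    (fun c ν k => LinearMap.ext fun x => by simp))
    (fun ν b k => by
      refine LinearMap.ext fun x => ?_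
      simp [hP, H.contract_smul])

@[simp]
theorem twist_tmul (H : HermitianForm C F) {X : Type*} [AddCommGroup X] [Module ℂ X]
    (P : Ω →ₛₗ[starRingEnd ℂ] Ω →ₗ[ℂ] X)
    (hP : ∀ (ω ν : Ω) (b : C.base), P (ν * b) ω = P ν (ω * C.baseStar b)) (ω ν : Ω) (f k : F) :
    H.twist P hP (tmul C.base ν k) (tmul C.base ω f) = P ν (ω * (H.h k f : Ω)) := rfl

/-- The map `(ω, ν) ↦ ω ∧ ν^*`, conjugate linear argument `ν` first. -/
def wedgeStar (C : StarCalculus Ω) : Ω →ₛₗ[starRingEnd ℂ] Ω →ₗ[ℂ] Ω where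
  toFun ν := LinearMap.mulRight ℂ (C.st ν)
  map_add' x y := by ext; simp [mul_add]
  map_smul' c x := by ext; simp

/-- The extension of `h_F` to `Ω ⊗_B F × Ω ⊗_B F → Ω`,
`h_F(ω ⊗ f, ν ⊗ k) = ω h_F(f, k) ∧ ν^*`. -/
def extend (H : HermitianForm C F) (α β : Forms C.base F) : Ω :=
  H.twist (wedgeStar C) (fun ω ν b => by simp [wedgeStar, C.st_mul_base, mul_assoc]) β α

/-- A connection `∇` is Hermitian if `d h_F(f, k) = h_F(∇f, 1 ⊗ k) + h_F(1 ⊗ f, ∇k)`. -/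
def IsHermitianConnection (H : HermitianForm C F) (N : Connection C.toDifferentialCalculus F) :
    Prop :=
  ∀ f k : F, C.d (H.h k f : Ω) =
    H.extend (N.toFun f) (tmul C.base 1 k) + H.extend (tmul C.base 1 f) (N.toFun k)

end HermitianForm

/-- The Chern connection of an Hermitian holomorphic module: an Hermitian connection `∇` with
`(0,1)`-part `∂̄_F`, that is, with `∇ f - ∂̄_F f ∈ Ω^{(1,0)} ⊗_B F` for all `f`. -/
def IsChernConnection {C : ComplexStructure Ω} {F : Type*} [AddCommGroup F] [Module ℂ F]
    [Module C.base F] [IsScalarTower ℂ C.base F] (H : HermitianForm C.toStarCalculus F)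
    (E : HolomorphicStructure C F) (N : Connection C.toDifferentialCalculus F) : Prop :=
  H.IsHermitianConnection N ∧ ∀ f : F, N.toFun f - E.toFun f ∈ formsIn F (C.bi (1, 0))

/-- An Hermitian holomorphic module over a Kähler structure is negative with curvature constant
`θ > 0` if its Chern connection satisfies `∇² f = θ i κ ⊗ f` for all `f`. -/
def IsNegativeModule {n : ℕ} (K : KahlerStructure Ω n) {F : Type*} [AddCommGroup F] [Module ℂ F]
    [Module K.base F] [IsScalarTower ℂ K.base F] (H : HermitianForm K.toStarCalculus F)
    (E : HolomorphicStructure K.toComplexStructure F) (θ : ℝ) : Prop :=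
  0 < θ ∧ ∃ N : Connection K.toDifferentialCalculus F, IsChernConnection H E N ∧
    ∀ f : F, N.curvature f = ((θ : ℂ) * Complex.I) • tmul K.base K.κ f

/-! ## Inner products, adjoints, Dolbeault–Dirac and Laplace operators -/

/-- The pairing `⟨α, β⟩_F = 𝐟 (g_F(α, β))` on `Ω ⊗_B F`, where
`g_F(ω ⊗ f, ν ⊗ k) = g(ω h_F(f, k), ν)`. -/
def innerF {n : ℕ} (K : KahlerStructure Ω n) (φ : K.State) {F : Type*} [AddCommGroup F]
    [Module ℂ F] [Module K.base F] [IsScalarTower ℂ K.base F]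
    (H : HermitianForm K.toStarCalculus F) (α β : Forms K.base F) : ℂ :=
  φ.toFun (H.twist K.metric K.metric_mul_base β α)

/-- The pairing `⟨·,·⟩_F` is positive definite. -/
def InnerPosDef {n : ℕ} (K : KahlerStructure Ω n) (φ : K.State) {F : Type*} [AddCommGroup F]
    [Module ℂ F] [Module K.base F] [IsScalarTower ℂ K.base F]
    (H : HermitianForm K.toStarCalculus F) : Prop :=
  ∀ α : Forms K.base F, α ≠ 0 → (innerF K φ H α α).im = 0 ∧ 0 < (innerF K φ H α α).re

/-- `S` is an adjoint of `T` with respect to `⟨·,·⟩_F`: `⟨Tα, β⟩_F = ⟨α, Sβ⟩_F`. -/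
def IsAdjoint {n : ℕ} (K : KahlerStructure Ω n) (φ : K.State) {F : Type*} [AddCommGroup F]
    [Module ℂ F] [Module K.base F] [IsScalarTower ℂ K.base F]
    (H : HermitianForm K.toStarCalculus F) (T S : Forms K.base F →ₗ[ℂ] Forms K.base F) : Prop :=
  ∀ α β : Forms K.base F, innerF K φ H (T α) β = innerF K φ H α (S β)

/-- `T` is adjointable with respect to `⟨·,·⟩_F`. -/
def IsAdjointable {n : ℕ} (K : KahlerStructure Ω n) (φ : K.State) {F : Type*} [AddCommGroup F]
    [Module ℂ F] [Module K.base F] [IsScalarTower ℂ K.base F]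
    (H : HermitianForm K.toStarCalculus F) (T : Forms K.base F →ₗ[ℂ] Forms K.base F) : Prop :=
  ∃ S : Forms K.base F →ₗ[ℂ] Forms K.base F, IsAdjoint K φ H T S

open Classical in
/-- The adjoint `T†` of an adjointable operator (the value is irrelevant for other operators). -/
def adjointF {n : ℕ} (K : KahlerStructure Ω n) (φ : K.State) {F : Type*} [AddCommGroup F]
    [Module ℂ F] [Module K.base F] [IsScalarTower ℂ K.base F]
    (H : HermitianForm K.toStarCalculus F) (T : Forms K.base F →ₗ[ℂ] Forms K.base F) :
    Forms K.base F →ₗ[ℂ] Forms K.base F :=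
  if h : IsAdjointable K φ H T then h.choose else 0

/-- The twisted Dolbeault–Dirac operator `D = ∂̄_F + ∂̄_F†` on `Ω ⊗_B F`. -/
def dolbeaultDirac {n : ℕ} (K : KahlerStructure Ω n) (φ : K.State) {F : Type*} [AddCommGroup F]
    [Module ℂ F] [Module K.base F] [IsScalarTower ℂ K.base F]
    (H : HermitianForm K.toStarCalculus F) (E : HolomorphicStructure K.toComplexStructure F) :
    Forms K.base F →ₗ[ℂ] Forms K.base F :=
  E.extend + adjointF K φ H E.extend

/-- The twisted anti-holomorphic Laplace operator `Δ = D²` on `Ω ⊗_B F`. -/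
def laplace {n : ℕ} (K : KahlerStructure Ω n) (φ : K.State) {F : Type*} [AddCommGroup F]
    [Module ℂ F] [Module K.base F] [IsScalarTower ℂ K.base F]
    (H : HermitianForm K.toStarCalculus F) (E : HolomorphicStructure K.toComplexStructure F) :
    Forms K.base F →ₗ[ℂ] Forms K.base F :=
  dolbeaultDirac K φ H E ∘ₗ dolbeaultDirac K φ H E

/-- The subspace `Ω^{(0,•)} ⊗_B F` of `Ω ⊗_B F`. -/
def antiHolForms (C : ComplexStructure Ω) (F : Type*) [AddCommGroup F] [Module ℂ F]
    [Module C.base F] : Submodule ℂ (Forms C.base F) :=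
  formsIn F (⨆ b : ℕ, C.bi (0, b))

end Modules

/-- `c` is an eigenvalue of `T` with an eigenvector in the subspace `W`; for a `T`-invariant `W`
these are the eigenvalues of `T : W → W`. -/
def IsEigenvalueOn {V : Type*} [AddCommGroup V] [Module ℂ V] (T : V →ₗ[ℂ] V) (W : Submodule ℂ V)
    (c : ℂ) : Prop :=
  ∃ v ∈ W, v ≠ 0 ∧ T v = c • v

/-- `T` is diagonalisable on the subspace `W`: `W` is spanned by eigenvectors of `T`. -/
def IsDiagonalisableOn {V : Type*} [AddCommGroup V] [Module ℂ V] (T : V →ₗ[ℂ] V)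
    (W : Submodule ℂ V) : Prop :=
  Submodule.span ℂ {v | v ∈ W ∧ ∃ c : ℂ, T v = c • v} = W

end NCKahler

end

/-! The argument is a Bochner–Kodaira–Nakano estimate in which explicit primitive decompositions
replace the dual Lefschetz operator. Split the Chern connection as ∇ = ∂_F + ∂̄_F. Stokes' theorem
for the closed integral, the graded Leibniz rule for h_F and ∗∗ = (-1)^{deg} give ∂̄_F† = -∗∂_F∗ and
∂_F† = -∗∂̄_F∗ (`isAdjoint_of_leibniz`, `isAdjoint_extend`, `isAdjoint_delConn`).

Let x have bidegree (0,k) with k < n, and write ∂_F x = γ₀ + κ∧γ₁ with γ₀ primitive. The formula for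
∗ on powers of κ times primitive forms gives ∂̄_F†x = -i(n-k+1)γ₁, and shows that ∂_F†γ₀ is i(n-k)
times the κ-coefficient of ∂̄_F γ₀ (`dbarAdj_eq`, `delAdj_eq`). The (1,1)-part of the curvature
equation, ∂_F∂̄_F + ∂̄_F∂_F = θiκ∧ (`delConn_extend_add`), identifies that coefficient. Pairing with
x, and using that primitive forms are orthogonal to multiples of κ (`innerF_wedge_primitive`),
yields ‖γ₀‖² = ‖∂̄_F x‖² + (n-k)/(n-k+1) ‖∂̄_F†x‖² - θ(n-k)‖x‖². The left side is non-negative, so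
⟨x, Δx⟩ ≥ θ(n-k)‖x‖² (`nakano_estimate`), which bounds every eigenvalue in degree k < n by θ from
below.

In degree (0,n) the operator ∂̄_F vanishes. For n ≥ 1, ∂̄_F† then carries an eigenvector with
non-zero eigenvalue to an eigenvector in degree (0,n-1) with the same eigenvalue; for n = 0, ∂̄_F†
vanishes too and there is no such eigenvector (`eigenvalue_of_homogeneous`). Since Δ preserves each
degree, homogeneous eigenvectors suffice. Finally Dx = μx implies Δx = μ²x, so θ ≤ Re μ² ≤ |μ|². -/

noncomputable section

namespace NCKahler

/-! ### Sign operator, Leibniz rules and bidegree components -/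

section Calculus

variable {Ω : Type*} [Ring Ω] [Algebra ℂ Ω]

namespace DifferentialCalculus

theorem sgn_sgn (C : DifferentialCalculus Ω) (ω : Ω) : C.sgn (C.sgn ω) = ω := by
  have : C.sgn ∘ₗ C.sgn = LinearMap.id := C.hom_ext fun k ω hω => by
    simp [C.sgn_of_mem hω, smul_smul, ← mul_pow]
  exact LinearMap.congr_fun this ω

theorem sgn_mul (C : DifferentialCalculus Ω) (ω η : Ω) : C.sgn (ω * η) = C.sgn ω * C.sgn η := by
  have : (LinearMap.mul ℂ Ω).compr₂ C.sgn = (LinearMap.mul ℂ Ω).compl₁₂ C.sgn C.sgn := by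
    refine C.hom_ext fun k ω hω => C.hom_ext fun l η hη => ?_
    have h := SetLike.GradedMul.mul_mem (A := C.gr) hω hη
    simp [C.sgn_of_mem hω, C.sgn_of_mem hη, C.sgn_of_mem h, pow_add, smul_smul, mul_comm]
  exact LinearMap.congr_fun₂ this ω η

theorem sgn_d (C : DifferentialCalculus Ω) (ω : Ω) : C.sgn (C.d ω) = -C.d (C.sgn ω) := by
  have : C.sgn ∘ₗ C.d = -(C.d ∘ₗ C.sgn) := C.hom_ext fun k ω hω => by
    simp [C.sgn_of_mem hω, C.sgn_of_mem (C.d_mem hω), pow_succ]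
  exact LinearMap.congr_fun this ω

/-- The graded Leibniz rule in terms of the sign operator. -/
theorem d_mul_eq (C : DifferentialCalculus Ω) (ω η : Ω) :
    C.d (ω * η) = C.d ω * η + C.sgn ω * C.d η := by
  have : C.d ∘ₗ LinearMap.mulRight ℂ η =
      LinearMap.mulRight ℂ η ∘ₗ C.d + LinearMap.mulRight ℂ (C.d η) ∘ₗ C.sgn := by
    refine C.hom_ext fun k ω hω => ?_
    simp [C.d_mul hω, C.sgn_of_mem hω]
  simpa using LinearMap.congr_fun this ω

end DifferentialCalculus

namespace StarCalculus

theorem sgn_st (C : StarCalculus Ω) (ω : Ω) : C.sgn (C.st ω) = C.st (C.sgn ω) := by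
  induction ω using DirectSum.Decomposition.inductionOn C.gr with
  | zero => simp
  | homogeneous x => simp [C.sgn_of_mem x.2, C.sgn_of_mem (C.st_mem x.2)]
  | add x y hx hy => simp [hx, hy]

/-- `(ω ∧ η)^* = η^* ∧ (sgn ω)^*` for a one-form `η`. -/
theorem st_mul_one_form (C : StarCalculus Ω) (ω : Ω) {η : Ω} (hη : η ∈ C.gr 1) :
    C.st (ω * η) = C.st η * C.st (C.sgn ω) := by
  induction ω using DirectSum.Decomposition.inductionOn C.gr with
  | zero => simp
  | homogeneous x => simp [C.sgn_of_mem x.2, C.st_mul x.2 hη]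
  | add x y hx hy => simp [hx, hy, add_mul, mul_add]

end StarCalculus

namespace ComplexStructure

theorem sgn_mem_bi (C : ComplexStructure Ω) {p : ℕ × ℕ} {ω : Ω} (h : ω ∈ C.bi p) :
    C.sgn ω ∈ C.bi p := by
  rw [C.sgn_of_mem (C.bi_le _ h)]; exact (C.bi p).smul_mem _ h

theorem eq_of_add_eq_add (C : ComplexStructure Ω) {p q : ℕ × ℕ} (hpq : p ≠ q) {x x' y y' : Ω}
    (hx : x ∈ C.bi p) (hx' : x' ∈ C.bi p) (hy : y ∈ C.bi q) (hy' : y' ∈ C.bi q)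
    (h : x + y = x' + y') : x = x' ∧ y = y' := by
  have h1 := congrArg (GradedAlgebra.proj C.bi p) h
  simp only [map_add, GradedAlgebra.proj_apply] at h1
  rw [DirectSum.decompose_of_mem_same _ hx, DirectSum.decompose_of_mem_same _ hx',
    DirectSum.decompose_of_mem_ne _ hy hpq.symm, DirectSum.decompose_of_mem_ne _ hy' hpq.symm,
    add_zero, add_zero] at h1
  subst h1
  exact ⟨rfl, add_left_cancel h⟩

theorem del_add_dbar (C : ComplexStructure Ω) (ω : Ω) : C.del ω + C.dbar ω = C.d ω := by
  rw [C.d_eq]; rfl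

/-- The Leibniz rule for d has terms in exactly two distinct bidegrees, and comparing them separates
it into one rule for ∂ and one for ∂̄. -/
theorem leibniz_of_mem (C : ComplexStructure Ω) {p q : ℕ × ℕ} {ω η : Ω} (hω : ω ∈ C.bi p)
    (hη : η ∈ C.bi q) : C.del (ω * η) = C.del ω * η + C.sgn ω * C.del η ∧
      C.dbar (ω * η) = C.dbar ω * η + C.sgn ω * C.dbar η := by
  obtain ⟨a, b⟩ := p
  obtain ⟨c, e⟩ := q
  have h := C.d_mul_eq ω η
  simp only [← C.del_add_dbar] at h
  have hp : C.del ω * η ∈ C.bi (a + c + 1, b + e) := by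
    have := C.bi_mul_mem (C.del_mem hω) hη
    convert this using 2; ext <;> simp; omega
  have hp' : C.sgn ω * C.del η ∈ C.bi (a + c + 1, b + e) :=
    C.bi_mul_mem (C.sgn_mem_bi hω) (C.del_mem hη)
  have hq : C.dbar ω * η ∈ C.bi (a + c, b + e + 1) := by
    have := C.bi_mul_mem (C.dbar_mem hω) hη
    convert this using 2; ext <;> simp; omega
  have hq' : C.sgn ω * C.dbar η ∈ C.bi (a + c, b + e + 1) :=
    C.bi_mul_mem (C.sgn_mem_bi hω) (C.dbar_mem hη)
  have hm := C.bi_mul_mem hω hη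
  refine C.eq_of_add_eq_add (p := (a + c + 1, b + e)) (q := (a + c, b + e + 1)) (by simp)
    (C.del_mem hm) (add_mem hp hp') (C.dbar_mem hm) (add_mem hq hq') ?_
  rw [h, add_mul, mul_add]; abel

theorem dbar_mul (C : ComplexStructure Ω) (ω η : Ω) :
    C.dbar (ω * η) = C.dbar ω * η + C.sgn ω * C.dbar η := by
  have : (LinearMap.mul ℂ Ω).compr₂ C.dbar =
      (LinearMap.mul ℂ Ω).compl₁₂ C.dbar .id + (LinearMap.mul ℂ Ω).compl₁₂ C.sgn C.dbar :=
    C.bihom_ext fun p ω hω => C.bihom_ext fun q η hη => (C.leibniz_of_mem hω hη).2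
  exact LinearMap.congr_fun₂ this ω η

theorem del_mul (C : ComplexStructure Ω) (ω η : Ω) :
    C.del (ω * η) = C.del ω * η + C.sgn ω * C.del η := by
  have : (LinearMap.mul ℂ Ω).compr₂ C.del =
      (LinearMap.mul ℂ Ω).compl₁₂ C.del .id + (LinearMap.mul ℂ Ω).compl₁₂ C.sgn C.del :=
    C.bihom_ext fun p ω hω => C.bihom_ext fun q η hη => (C.leibniz_of_mem hω hη).1
  exact LinearMap.congr_fun₂ this ω η

/-- The involution commutes with d and swaps the two indices of a bidegree, so it exchanges the two
components of d. -/
theorem st_del_dbar (C : ComplexStructure Ω) (ω : Ω) :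
    C.st (C.del ω) = C.dbar (C.st ω) ∧ C.st (C.dbar ω) = C.del (C.st ω) := by
  induction ω using DirectSum.Decomposition.inductionOn C.bi with
  | zero => simp
  | @homogeneous p x =>
    obtain ⟨a, b⟩ := p
    have h := C.st_d x
    rw [← C.del_add_dbar, ← C.del_add_dbar, map_add, add_comm (C.del _)] at h
    exact C.eq_of_add_eq_add (p := (b, a + 1)) (q := (b + 1, a)) (by simp)
      (C.st_bi (C.del_mem x.2)) (C.dbar_mem (C.st_bi x.2)) (C.st_bi (C.dbar_mem x.2))
      (C.del_mem (C.st_bi x.2)) h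
  | add x y hx hy => simp [hx, hy]

theorem st_del (C : ComplexStructure Ω) (ω : Ω) : C.st (C.del ω) = C.dbar (C.st ω) :=
  (C.st_del_dbar ω).1

theorem st_dbar (C : ComplexStructure Ω) (ω : Ω) : C.st (C.dbar ω) = C.del (C.st ω) :=
  (C.st_del_dbar ω).2

theorem sgn_dbar (C : ComplexStructure Ω) (ω : Ω) : C.sgn (C.dbar ω) = -C.dbar (C.sgn ω) := by
  have : C.sgn ∘ₗ C.dbar = -(C.dbar ∘ₗ C.sgn) := C.bihom_ext fun ⟨a, b⟩ ω hω => by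
    simp [C.sgn_of_mem (C.bi_le _ hω), C.sgn_of_mem (C.bi_le _ (C.dbar_mem hω)), ← add_assoc,
      pow_succ]
  exact LinearMap.congr_fun this ω

/-- This is the (0,2)-component of d² = 0. -/
theorem dbar_dbar (C : ComplexStructure Ω) (ω : Ω) : C.dbar (C.dbar ω) = 0 := by
  have : C.dbar ∘ₗ C.dbar = 0 := C.bihom_ext fun ⟨a, b⟩ ω hω => by
    have h := C.d_d ω
    rw [← C.del_add_dbar ω, map_add, ← C.del_add_dbar, ← C.del_add_dbar] at h
    have h1 := congrArg (GradedAlgebra.proj C.bi (a, b + 2)) h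
    simp only [map_add, GradedAlgebra.proj_apply] at h1
    rw [DirectSum.decompose_of_mem_ne _ (C.del_mem (C.del_mem hω)) (by simp),
      DirectSum.decompose_of_mem_ne _ (C.dbar_mem (C.del_mem hω)) (by simp),
      DirectSum.decompose_of_mem_ne _ (C.del_mem (C.dbar_mem hω)) (by simp),
      DirectSum.decompose_of_mem_same _ (C.dbar_mem (C.dbar_mem hω))] at h1
    simpa using h1
  exact LinearMap.congr_fun this ω

theorem proj_mul_base (C : ComplexStructure Ω) (p : ℕ × ℕ) (ω : Ω) (b : C.base) :
    GradedAlgebra.proj C.bi p (ω * b) = GradedAlgebra.proj C.bi p ω * b := by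
  have : GradedAlgebra.proj C.bi p ∘ₗ LinearMap.mulRight ℂ (b : Ω) =
      LinearMap.mulRight ℂ (b : Ω) ∘ₗ GradedAlgebra.proj C.bi p := by
    refine C.bihom_ext fun q ω hω => ?_
    have h := C.bi_mul_mem hω (C.base_mem_bi b)
    rw [show q + (0, 0) = q from add_zero q] at h
    simp only [LinearMap.comp_apply, LinearMap.mulRight_apply, GradedAlgebra.proj_apply]
    by_cases hpq : q = p
    · subst hpq
      rw [DirectSum.decompose_of_mem_same _ h, DirectSum.decompose_of_mem_same _ hω]
    · rw [DirectSum.decompose_of_mem_ne _ h hpq, DirectSum.decompose_of_mem_ne _ hω hpq, zero_mul]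
  exact LinearMap.congr_fun this ω

end ComplexStructure

/-! ### Lefschetz decomposition by bidegree, the Hodge map and the integral -/

namespace KahlerStructure

variable {n : ℕ}

/-- The bihomogeneous Lefschetz decomposition. -/
theorem bi_le_span (K : KahlerStructure Ω n) (p : ℕ × ℕ) :
    K.bi p ≤ Submodule.span ℂ {y | ∃ (a b j : ℕ) (x : Ω), j + (a + b) ≤ n ∧ (j + a, j + b) = p ∧
      x ∈ K.primitive (a, b) ∧ y = K.κ ^ j * x} := by
  intro ω hω
  set S := Submodule.span ℂ {y | ∃ (a b j : ℕ) (x : Ω), j + (a + b) ≤ n ∧ (j + a, j + b) = p ∧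
      x ∈ K.primitive (a, b) ∧ y = K.κ ^ j * x}
  -- Each generator of the decomposition by total degree is already bihomogeneous, so projecting to
  -- bidegree p either keeps it or kills it.
  have : K.lefschetzSpan (p.1 + p.2) ≤ S.comap (GradedAlgebra.proj K.bi p) := by
    refine Submodule.span_le.2 ?_
    rintro _ ⟨a, b, j, x, h1, -, hx, rfl⟩
    have hm : K.κ ^ j * x ∈ K.bi (j + a, j + b) := K.κ_pow_mul_mem_bi j (mem_primitive.1 hx).1
    simp only [Submodule.comap_coe, Set.mem_preimage, SetLike.mem_coe, GradedAlgebra.proj_apply]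
    by_cases h : (j + a, j + b) = p
    · rw [h] at hm
      rw [DirectSum.decompose_of_mem_same _ hm]
      exact Submodule.subset_span ⟨a, b, j, x, h1, h, hx, rfl⟩
    · rw [DirectSum.decompose_of_mem_ne _ hm h]
      exact S.zero_mem
  have h := this (K.gr_le_lefschetzSpan _ (K.bi_le p hω))
  rw [Submodule.mem_comap, GradedAlgebra.proj_apply, DirectSum.decompose_of_mem_same _ hω] at h
  exact h

/-- A non-zero κ^j α with α primitive of bidegree (a,b) has j + a + b ≤ n, which bounds both j + a
and j + b by n. -/
theorem bi_eq_bot (K : KahlerStructure Ω n) {p : ℕ × ℕ} (hp : n < p.1 ∨ n < p.2) :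
    K.bi p = ⊥ := by
  rw [eq_bot_iff]
  refine (K.bi_le_span p).trans (Submodule.span_le.2 ?_)
  rintro _ ⟨a, b, j, x, h1, rfl, -, -⟩
  simp only at hp
  omega

/-- Multiplication by κ^{n+1-k} would raise the second index to n + 1, where there are no forms. -/
theorem bi_zero_le_primitive (K : KahlerStructure Ω n) (k : ℕ) :
    K.bi (0, k) ≤ K.primitive (0, k) := by
  intro x hx
  by_cases hk : k ≤ n
  · refine mem_primitive.2 ⟨hx, ?_⟩
    have h := K.κ_pow_mul_mem_bi (n + 1 - (0 + k)) hx
    rw [K.bi_eq_bot (Or.inr (by simp; omega))] at h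
    simpa using h
  · rw [K.bi_eq_bot (Or.inr (by simp; omega))] at hx
    rw [(Submodule.mem_bot ℂ).1 hx]
    exact Submodule.zero_mem _

/-- With first index 1, only κ⁰ and κ¹ can occur in the Lefschetz decomposition. -/
theorem bi_one_succ (K : KahlerStructure Ω n) (k : ℕ) {ω : Ω} (hω : ω ∈ K.bi (1, k + 1)) :
    ∃ ω₀ ∈ K.primitive (1, k + 1), ∃ ω₁ ∈ K.bi (0, k), ω = ω₀ + K.κ * ω₁ := by
  have : K.bi (1, k + 1) ≤
      K.primitive (1, k + 1) ⊔ (K.bi (0, k)).map (LinearMap.mulLeft ℂ K.κ) := by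
    refine (K.bi_le_span _).trans (Submodule.span_le.2 ?_)
    rintro _ ⟨a, b, j, x, h1, h2, hx, rfl⟩
    simp only [Prod.mk.injEq] at h2
    obtain rfl | rfl : j = 0 ∨ j = 1 := by omega
    · refine Submodule.mem_sup_left ?_
      obtain ⟨rfl, rfl⟩ : a = 1 ∧ b = k + 1 := by omega
      simpa using hx
    · refine Submodule.mem_sup_right ?_
      obtain ⟨rfl, rfl⟩ : a = 0 ∧ b = k := by omega
      exact ⟨x, (mem_primitive.1 hx).1, by simp⟩
  obtain ⟨x, hx, _, ⟨y, hy, rfl⟩, h⟩ := Submodule.mem_sup.1 (this hω)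
  exact ⟨x, hx, y, hy, h.symm⟩

theorem bi_one_zero_le_primitive (K : KahlerStructure Ω n) : K.bi (1, 0) ≤ K.primitive (1, 0) := by
  refine (K.bi_le_span _).trans (Submodule.span_le.2 ?_)
  rintro _ ⟨a, b, j, x, h1, h2, hx, rfl⟩
  simp only [Prod.mk.injEq] at h2
  obtain ⟨rfl, rfl, rfl⟩ : j = 0 ∧ a = 1 ∧ b = 0 := by omega
  simpa using hx

theorem primitive_mul_base (K : KahlerStructure Ω n) (b : K.base) {p : ℕ × ℕ} {x : Ω}
    (hx : x ∈ K.primitive p) : x * b ∈ K.primitive p := by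
  rw [mem_primitive] at hx ⊢
  have h := K.bi_mul_mem hx.1 (K.base_mem_bi b)
  rw [show p + (0, 0) = p from add_zero p] at h
  refine ⟨h, ?_⟩
  rw [← mul_assoc, hx.2, zero_mul]

/-- The Hodge map is right `B`-linear. -/
theorem hodge_mul_base (K : KahlerStructure Ω n) (ω : Ω) (b : K.base) :
    K.hodge (ω * b) = K.hodge ω * b := by
  have : K.hodge ∘ₗ LinearMap.mulRight ℂ (b : Ω) = LinearMap.mulRight ℂ (b : Ω) ∘ₗ K.hodge := by
    refine K.lefschetz_ext fun a c j x hj hx => ?_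
    simp only [LinearMap.comp_apply, LinearMap.mulRight_apply]
    rw [mul_assoc, K.hodge_spec a c j hj _ (K.primitive_mul_base b hx), K.hodge_spec a c j hj x hx,
      smul_mul_assoc, ← mul_assoc (K.κ ^ _) x]
  exact LinearMap.congr_fun this ω

/-- The form κ is real, central and of even degree, so reversing the product costs no sign. -/
theorem st_κ_pow_mul (K : KahlerStructure Ω n) (j : ℕ) (ω : Ω) :
    K.st (K.κ ^ j * ω) = K.κ ^ j * K.st ω := by
  induction j with
  | zero => simp
  | succ j ih =>
    rw [pow_succ', mul_assoc, mul_assoc, ← ih]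
    generalize K.κ ^ j * ω = η
    have hκ : K.κ ∈ K.gr 2 := K.bi_le _ K.κ_mem
    induction η using DirectSum.Decomposition.inductionOn K.gr with
    | zero => simp
    | @homogeneous i x =>
      rw [K.st_mul hκ x.2, K.κ_real, K.κ_central]; simp [pow_mul]
    | add x y hx hy => simp only [mul_add, map_add, hx, hy]

theorem st_mem_primitive (K : KahlerStructure Ω n) {a b : ℕ} {x : Ω}
    (hx : x ∈ K.primitive (a, b)) : K.st x ∈ K.primitive (b, a) := by
  rw [mem_primitive] at hx ⊢
  refine ⟨K.st_bi hx.1, ?_⟩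
  have := congrArg K.st hx.2
  rw [K.st_κ_pow_mul, map_zero] at this
  simpa [add_comm] using this

/-- The involution swaps a and b, turning i^{a-b} into i^{b-a}, and complex conjugation of the
coefficient undoes this. -/
theorem hodge_st (K : KahlerStructure Ω n) (ω : Ω) : K.hodge (K.st ω) = K.st (K.hodge ω) := by
  -- Conjugating by the involution gives an identity between linear maps, so it can be tested on the
  -- Lefschetz generators.
  have : K.st.comp (K.hodge ∘ₛₗ K.st) = K.hodge := by
    refine K.lefschetz_ext fun a b j x hj hx => ?_
    simp only [LinearMap.comp_apply]
    rw [K.st_κ_pow_mul, K.hodge_spec b a j (by omega) _ (K.st_mem_primitive hx),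
      K.hodge_spec a b j hj x hx, map_smulₛₗ, K.st_κ_pow_mul, K.st_st]
    congr 1
    · simp only [map_mul, map_pow, map_neg, map_one, map_zpow₀, Complex.conj_I, map_div₀,
        map_natCast, add_comm b a]
      congr 2
      rw [← Complex.inv_I, inv_zpow', neg_sub]
    · rw [add_comm b a]
  have h := LinearMap.congr_fun this ω
  simp only [LinearMap.comp_apply] at h
  rw [← h, K.st_st]

/-- The exponents j and n-j-k exchange roles, so the factorials cancel; the triangular sign squares
to 1, and i^{2(a-b)} = (-1)^{a+b} remains. -/
theorem hodge_hodge (K : KahlerStructure Ω n) (ω : Ω) : K.hodge (K.hodge ω) = K.sgn ω := by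
  have : K.hodge ∘ₗ K.hodge = K.sgn := by
    refine K.lefschetz_ext fun a b j x hj hx => ?_
    have hm := K.κ_pow_mul_mem_gr j (K.bi_le _ (mem_primitive.1 hx).1)
    simp only [LinearMap.comp_apply]
    rw [K.hodge_spec a b j hj x hx, map_smul, K.hodge_spec a b _ (by omega) x hx, smul_smul,
      K.sgn_of_mem hm, show n - (n - j - (a + b)) - (a + b) = j by omega]
    congr 1
    have h1 : ((n - j - (a + b)).factorial : ℂ) ≠ 0 := by exact_mod_cast Nat.factorial_ne_zero _
    have h2 : (j.factorial : ℂ) ≠ 0 := by exact_mod_cast Nat.factorial_ne_zero _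
    have h3 : ∀ m : ℕ, ((-1 : ℂ) ^ m) * (-1) ^ m = 1 := fun m => by rw [← mul_pow]; simp
    have h4 : Complex.I ^ ((a : ℤ) - b) * Complex.I ^ ((a : ℤ) - b) = (-1) ^ (a + b) := by
      rw [← mul_zpow, Complex.I_mul_I, zpow_sub₀ (by simp), zpow_natCast, zpow_natCast, pow_add,
        div_eq_iff (by simp), mul_assoc, h3, mul_one]
    rw [pow_add, pow_mul]
    simp only [neg_one_sq, one_pow, one_mul]
    rw [← h4]
    field_simp
    rw [← pow_mul, mul_comm _ 2, pow_mul]; simp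
  exact LinearMap.congr_fun this ω

theorem del_κ (K : KahlerStructure Ω n) : K.del K.κ = 0 ∧ K.dbar K.κ = 0 := by
  have h := K.κ_closed
  rw [← K.del_add_dbar, ← add_zero (0 : Ω)] at h
  exact K.eq_of_add_eq_add (p := (2, 1)) (q := (1, 2)) (by simp) (K.del_mem K.κ_mem)
    (zero_mem _) (K.dbar_mem K.κ_mem) (zero_mem _) h

theorem sgn_κ (K : KahlerStructure Ω n) : K.sgn K.κ = K.κ := by
  rw [K.sgn_of_mem (K.bi_le _ K.κ_mem)]; simp

theorem integral_of_ne (K : KahlerStructure Ω n) (φ : K.State) {k : ℕ} (hk : k ≠ 2 * n) {ω : Ω}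
    (hω : ω ∈ K.gr k) : K.integral φ ω = 0 := by
  rcases lt_or_gt_of_ne hk with hk | hk
  · have h : K.toBase (K.hodge ω) = 0 := by
      ext
      simp only [DifferentialCalculus.toBase, GradedAlgebra.proj_apply]
      exact DirectSum.decompose_of_mem_ne _ (K.hodge_mem hω) (by omega)
    simp [integral, h]
  · rw [K.above_eq_bot _ hk, Submodule.mem_bot] at hω
    simp [hω]

/-- The integral only sees degree 2n, which is even. -/
theorem integral_sgn (K : KahlerStructure Ω n) (φ : K.State) (ω : Ω) :
    K.integral φ (K.sgn ω) = K.integral φ ω := by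
  have : K.integral φ ∘ₗ K.sgn = K.integral φ := K.hom_ext fun k ω hω => by
    rw [LinearMap.comp_apply, K.sgn_of_mem hω, map_smul]
    by_cases hk : k = 2 * n
    · simp [hk, pow_mul]
    · simp [K.integral_of_ne φ hk hω]
  exact LinearMap.congr_fun this ω

/-- In total degree 2n only bidegree (n,n) is non-zero, so at most one of ∂ω and ∂̄ω survives and
closedness of the integral applies to it alone. -/
theorem integral_del_dbar (K : KahlerStructure Ω n) {φ : K.State} (hφ : K.ClosedIntegral φ)
    {a b : ℕ} {ω : Ω} (hω : ω ∈ K.bi (a, b)) :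
    K.integral φ (K.del ω) = 0 ∧ K.integral φ (K.dbar ω) = 0 := by
  have h1 := K.del_mem hω
  have h2 := K.dbar_mem hω
  by_cases hab : a + b + 1 = 2 * n
  · have h := hφ (a + b) ω hab (K.bi_le _ hω)
    rw [← K.del_add_dbar, map_add] at h
    by_cases ha : n < a + 1
    · rw [K.bi_eq_bot (Or.inl (by simpa using ha)), Submodule.mem_bot] at h1
      rw [h1] at h ⊢
      simpa using h
    · rw [K.bi_eq_bot (Or.inr (by simp; omega)), Submodule.mem_bot] at h2
      rw [h2] at h ⊢
      simpa using h
  · exact ⟨K.integral_of_ne φ (by simp; omega) (K.bi_le _ h1),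
      K.integral_of_ne φ (by simp; omega) (K.bi_le _ h2)⟩

theorem integral_del (K : KahlerStructure Ω n) {φ : K.State} (hφ : K.ClosedIntegral φ) (ω : Ω) :
    K.integral φ (K.del ω) = 0 :=
  LinearMap.congr_fun (f := K.integral φ ∘ₗ K.del) (g := 0)
    (K.bihom_ext fun ⟨_, _⟩ _ hω => (K.integral_del_dbar hφ hω).1) ω

theorem integral_dbar (K : KahlerStructure Ω n) {φ : K.State} (hφ : K.ClosedIntegral φ) (ω : Ω) :
    K.integral φ (K.dbar ω) = 0 :=
  LinearMap.congr_fun (f := K.integral φ ∘ₗ K.dbar) (g := 0)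
    (K.bihom_ext fun ⟨_, _⟩ _ hω => (K.integral_del_dbar hφ hω).2) ω

end KahlerStructure

end Calculus

/-! ### Linear maps and graded subspaces of Ω ⊗_B F -/

section FormsMap

variable {Ω : Type*} [Ring Ω] [Algebra ℂ Ω] {B : Subalgebra ℂ Ω}
  {F : Type*} [AddCommGroup F] [Module ℂ F] [Module B F]

theorem forms_induction {P : Forms B F → Prop} (zero : P 0)
    (add : ∀ x y, P x → P y → P (x + y)) (tmul : ∀ (ω : Ω) (f : F), P (tmul B ω f))
    (x : Forms B F) : P x := by
  obtain ⟨y, rfl⟩ := (balanced B F).mkQ_surjective x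
  induction y with
  | zero => simpa using zero
  | tmul ω f => exact tmul ω f
  | add x y hx hy => rw [map_add]; exact add _ _ hx hy

variable (F) in
/-- The endomorphism `u ⊗ id` of `Ω ⊗_B F` for a right `B`-linear endomorphism `u` of `Ω`. -/
def formsMap (u : Ω →ₗ[ℂ] Ω) (hu : ∀ (ω : Ω) (b : B), u (ω * b) = u ω * b) :
    Forms B F →ₗ[ℂ] Forms B F :=
  formsLift (LinearMap.mk₂ ℂ (fun ω f => tmul B (u ω) f)
    (fun ω η f => by rw [map_add, tmul_add_left])
    (fun c ω f => by rw [map_smul, tmul_smul_left])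
    (fun ω f f' => tmul_add_right _ _ _)
    (fun c ω f => tmul_smul_right _ _ _))
    (fun ω b f => by simp [hu, tmul_base])

@[simp]
theorem formsMap_tmul (u : Ω →ₗ[ℂ] Ω) (hu : ∀ (ω : Ω) (b : B), u (ω * b) = u ω * b)
    (ω : Ω) (f : F) : formsMap F u hu (tmul B ω f) = tmul B (u ω) f := rfl

theorem tmul_mem_formsIn {S : Submodule ℂ Ω} {ω : Ω} (hω : ω ∈ S) (f : F) :
    tmul B ω f ∈ formsIn F S :=
  Submodule.subset_span ⟨ω, hω, f, rfl⟩

/-- A linear map sends `S ⊗_B F` into a subspace if it does so on elementary tensors. -/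
theorem map_mem_of_mem_formsIn {M : Type*} [AddCommGroup M] [Module ℂ M] {S : Submodule ℂ Ω}
    {T : Submodule ℂ M} {u : Forms B F →ₗ[ℂ] M} (hu : ∀ ω ∈ S, ∀ f : F, u (tmul B ω f) ∈ T)
    {x : Forms B F} (hx : x ∈ formsIn F S) : u x ∈ T := by
  have : formsIn F S ≤ T.comap u := Submodule.span_le.2 <| by
    rintro _ ⟨ω, hω, f, rfl⟩
    exact hu ω hω f
  exact this hx

/-- Two linear maps agree on `S ⊗_B F` if they agree on its elementary tensors. -/
theorem eqOn_formsIn {M : Type*} [AddCommGroup M] [Module ℂ M] {S : Submodule ℂ Ω}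
    {u v : Forms B F →ₗ[ℂ] M} (h : ∀ ω ∈ S, ∀ f : F, u (tmul B ω f) = v (tmul B ω f))
    {x : Forms B F} (hx : x ∈ formsIn F S) : u x = v x := by
  have : formsIn F S ≤ LinearMap.eqLocus u v := Submodule.span_le.2 <| by
    rintro _ ⟨ω, hω, f, rfl⟩
    exact h ω hω f
  exact this hx

theorem formsIn_mono {S T : Submodule ℂ Ω} (h : S ≤ T) :
    formsIn (B := B) F S ≤ formsIn F T :=
  fun _ => map_mem_of_mem_formsIn (u := LinearMap.id) fun _ hω f => tmul_mem_formsIn (h hω) f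

theorem formsIn_bot : formsIn (B := B) F (⊥ : Submodule ℂ Ω) = ⊥ := by
  rw [eq_bot_iff]
  refine fun _ => map_mem_of_mem_formsIn (u := LinearMap.id) fun ω hω f => ?_
  rw [(Submodule.mem_bot ℂ).1 hω]
  simp [tmul]

theorem wedge_mem {η : Ω} {S T : Submodule ℂ Ω} (h : ∀ ω ∈ S, η * ω ∈ T) {x : Forms B F}
    (hx : x ∈ formsIn F S) : wedge η x ∈ formsIn F T :=
  map_mem_of_mem_formsIn (fun ω hω f => tmul_mem_formsIn (h ω hω) f) hx

end FormsMap

/-! ### Extended connections and their bidegree components -/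

section ExtendConn

variable {Ω : Type*} [Ring Ω] [Algebra ℂ Ω] {F : Type*} [AddCommGroup F] [Module ℂ F]

section Differential

variable {C : DifferentialCalculus Ω} [Module C.base F] {δ : Ω →ₗ[ℂ] Ω}
  {hδ : ∀ (ω : Ω) (b : C.base), δ (ω * b) = δ ω * b + C.sgn ω * δ b}
  {D : F →ₗ[ℂ] Forms C.base F}
  {hD : ∀ (b : C.base) (f : F), D (b • f) = tmul C.base (δ b) f + wedge (b : Ω) (D f)}

@[simp]
theorem extendConn_tmul (ω : Ω) (f : F) :
    extendConn C δ hδ D hD (tmul C.base ω f) = tmul C.base (δ ω) f + wedge (C.sgn ω) (D f) :=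
  rfl

theorem extendConn_wedge (h : ∀ ω η : Ω, δ (ω * η) = δ ω * η + C.sgn ω * δ η) (η : Ω)
    (x : Forms C.base F) :
    extendConn C δ hδ D hD (wedge η x) =
      wedge (δ η) x + wedge (C.sgn η) (extendConn C δ hδ D hD x) := by
  induction x using forms_induction with
  | zero => simp
  | add x y hx hy => simp only [map_add, hx, hy]; abel
  | tmul ω f => simp [h, C.sgn_mul, tmul_add_left, wedge_mul, add_assoc]

/-- The sign operator anticommutes with δ, so the cross terms cancel: the square of the extension is
Ω-linear, hence determined by the curvature on F. -/
theorem extendConn_extendConn (h : ∀ ω η : Ω, δ (ω * η) = δ ω * η + C.sgn ω * δ η)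
    (hsgn : ∀ ω, C.sgn (δ ω) = -δ (C.sgn ω)) (h2 : ∀ ω, δ (δ ω) = 0) (ω : Ω) (f : F) :
    extendConn C δ hδ D hD (extendConn C δ hδ D hD (tmul C.base ω f)) =
      wedge ω (extendConn C δ hδ D hD (D f)) := by
  simp only [extendConn_tmul, map_add, extendConn_wedge h, h2, hsgn, C.sgn_sgn]
  simp [tmul]

/-- The sign operator `ω ⊗ f ↦ (-1)^{|ω|} ω ⊗ f`. -/
def sgnF (C : DifferentialCalculus Ω) (F : Type*) [AddCommGroup F] [Module ℂ F]
    [Module C.base F] : Forms C.base F →ₗ[ℂ] Forms C.base F :=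
  formsMap F C.sgn C.sgn_mul_base

@[simp]
theorem sgnF_tmul (ω : Ω) (f : F) : sgnF C F (tmul C.base ω f) = tmul C.base (C.sgn ω) f := rfl

end Differential

section Complex

variable {C : ComplexStructure Ω} [Module C.base F]

/-- The projection of `Ω ⊗_B F` onto its part of bidegree `p`. -/
def projF (C : ComplexStructure Ω) (F : Type*) [AddCommGroup F] [Module ℂ F]
    [Module C.base F] (p : ℕ × ℕ) : Forms C.base F →ₗ[ℂ] Forms C.base F :=
  formsMap F (GradedAlgebra.proj C.bi p) (C.proj_mul_base p)

theorem projF_of_mem {p : ℕ × ℕ} {x : Forms C.base F} (hx : x ∈ formsIn F (C.bi p)) :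
    projF C F p x = x := by
  refine eqOn_formsIn (v := LinearMap.id) (fun ω hω f => ?_) hx
  simp only [projF, formsMap_tmul, GradedAlgebra.proj_apply, LinearMap.id_apply]
  rw [DirectSum.decompose_of_mem_same _ hω]

theorem projF_of_mem_ne {p q : ℕ × ℕ} (hpq : q ≠ p) {x : Forms C.base F}
    (hx : x ∈ formsIn F (C.bi q)) : projF C F p x = 0 := by
  refine eqOn_formsIn (v := 0) (fun ω hω f => ?_) hx
  simp only [projF, formsMap_tmul, GradedAlgebra.proj_apply, LinearMap.zero_apply]
  rw [DirectSum.decompose_of_mem_ne _ hω hpq]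
  simp [tmul]

/-- The `(1,0)`-part `∂_F` of a connection with `(0,1)`-part `∂̄_F`. -/
def delConn (N : Connection C.toDifferentialCalculus F) (E : ZeroOneConnection C F) :
    Forms C.base F →ₗ[ℂ] Forms C.base F :=
  extendConn C.toDifferentialCalculus C.del (fun ω b => C.del_mul ω b) (N.toFun - E.toFun)
    (fun b f => by
      rw [LinearMap.sub_apply, LinearMap.sub_apply, N.leibniz, E.leibniz, ← C.del_add_dbar,
        tmul_add_left, map_sub]
      abel)

theorem delConn_tmul (N : Connection C.toDifferentialCalculus F) (E : ZeroOneConnection C F)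
    (ω : Ω) (f : F) : delConn N E (tmul C.base ω f) =
      tmul C.base (C.del ω) f + wedge (C.sgn ω) (N.toFun f - E.toFun f) := rfl

theorem ZeroOneConnection.extend_tmul (E : ZeroOneConnection C F) (ω : Ω) (f : F) :
    E.extend (tmul C.base ω f) =
      tmul C.base (C.dbar ω) f + wedge (C.sgn ω) (E.toFun f) := rfl

theorem delConn_add_extend (N : Connection C.toDifferentialCalculus F) (E : ZeroOneConnection C F)
    (x : Forms C.base F) : delConn N E x + E.extend x = N.extend x := by
  induction x using forms_induction with
  | zero => simp
  | add x y hx hy => rw [map_add, map_add, map_add, ← hx, ← hy]; abel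
  | tmul ω f =>
    rw [delConn_tmul, E.extend_tmul]
    change _ = tmul C.base (C.d ω) f + wedge (C.sgn ω) (N.toFun f)
    rw [← C.del_add_dbar, tmul_add_left, map_sub]
    abel

theorem ZeroOneConnection.extend_mem (E : ZeroOneConnection C F) {a b : ℕ} {x : Forms C.base F}
    (hx : x ∈ formsIn F (C.bi (a, b))) : E.extend x ∈ formsIn F (C.bi (a, b + 1)) := by
  refine map_mem_of_mem_formsIn (u := E.extend) (fun ω hω f => ?_) hx
  have h : wedge (C.sgn ω) (E.toFun f) ∈ formsIn F (C.bi ((a, b) + (0, 1))) :=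
    wedge_mem (fun η hη => C.bi_mul_mem (C.sgn_mem_bi hω) hη) (E.mem f)
  rw [E.extend_tmul]
  exact add_mem (tmul_mem_formsIn (C.dbar_mem hω) f) h

theorem delConn_mem {N : Connection C.toDifferentialCalculus F} {E : ZeroOneConnection C F}
    (hN : ∀ f : F, N.toFun f - E.toFun f ∈ formsIn F (C.bi (1, 0))) {a b : ℕ} {x : Forms C.base F}
    (hx : x ∈ formsIn F (C.bi (a, b))) : delConn N E x ∈ formsIn F (C.bi (a + 1, b)) := by
  refine map_mem_of_mem_formsIn (u := delConn N E) (fun ω hω f => ?_) hx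
  have h : wedge (C.sgn ω) (N.toFun f - E.toFun f) ∈ formsIn F (C.bi ((a, b) + (1, 0))) :=
    wedge_mem (fun η hη => C.bi_mul_mem (C.sgn_mem_bi hω) hη) (hN f)
  rw [delConn_tmul]
  exact add_mem (tmul_mem_formsIn (C.del_mem hω) f) h

theorem HolomorphicStructure.extend_extend (E : HolomorphicStructure C F) (x : Forms C.base F) :
    E.extend (E.extend x) = 0 := by
  induction x using forms_induction with
  | zero => simp
  | add x y hx hy => simp [hx, hy]
  | tmul ω f =>
    have := extendConn_extendConn (hδ := C.dbar_mul_base) (D := E.toFun) (hD := E.leibniz)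
      C.dbar_mul C.sgn_dbar C.dbar_dbar ω f
    refine this.trans ?_
    change wedge ω (E.extend (E.toFun f)) = 0
    rw [E.flat, map_zero]

end Complex

end ExtendConn

/-! ### The pairing h_F on forms: Leibniz rule and Chern connection -/

namespace HermitianForm

variable {Ω : Type*} [Ring Ω] [Algebra ℂ Ω] {F : Type*} [AddCommGroup F] [Module ℂ F]

section Star

variable {C : StarCalculus Ω} [Module C.base F] [IsScalarTower ℂ C.base F]

theorem extend_tmul (H : HermitianForm C F) (ω ν : Ω) (f k : F) :
    H.extend (tmul C.base ω f) (tmul C.base ν k) = ω * (H.h k f : Ω) * C.st ν := rfl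

theorem extend_add_left (H : HermitianForm C F) (x x' y : Forms C.base F) :
    H.extend (x + x') y = H.extend x y + H.extend x' y := by simp [extend]

theorem extend_add_right (H : HermitianForm C F) (x y y' : Forms C.base F) :
    H.extend x (y + y') = H.extend x y + H.extend x y' := by simp [extend]

theorem extend_neg_right (H : HermitianForm C F) (x y : Forms C.base F) :
    H.extend x (-y) = -H.extend x y := by simp [extend]

theorem extend_zero_left (H : HermitianForm C F) (y : Forms C.base F) :
    H.extend 0 y = 0 := by simp [extend]

theorem extend_zero_right (H : HermitianForm C F) (x : Forms C.base F) :
    H.extend x 0 = 0 := by simp [extend]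

theorem extend_wedge_left (H : HermitianForm C F) (η : Ω) (x y : Forms C.base F) :
    H.extend (wedge η x) y = η * H.extend x y := by
  induction x using forms_induction with
  | zero => simp [extend_zero_left]
  | add x x' hx hx' => simp only [map_add, extend_add_left, hx, hx', mul_add]
  | tmul ω f =>
    induction y using forms_induction with
    | zero => simp [extend_zero_right]
    | add y y' hy hy' => simp only [extend_add_right, hy, hy', mul_add]
    | tmul ν k => simp [extend_tmul, mul_assoc]

theorem extend_tmul_right (H : HermitianForm C F) (x : Forms C.base F) (ν : Ω) (k : F) :
    H.extend x (tmul C.base ν k) = H.extend x (tmul C.base 1 k) * C.st ν := by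
  induction x using forms_induction with
  | zero => simp [extend_zero_left]
  | add x x' hx hx' => simp only [extend_add_left, hx, hx', add_mul]
  | tmul ω f => simp [extend_tmul, C.st_one]

/-- The sign from reversing ν and a one-form is exactly the one that an extended connection puts in
front of its second term; the two cancel. -/
theorem extend_wedge_sgn_right (H : HermitianForm C F) (ν : Ω) (x : Forms C.base F)
    {y : Forms C.base F} (hy : y ∈ formsIn F (C.gr 1)) :
    H.extend x (wedge (C.sgn ν) y) = H.extend x y * C.st ν := by
  -- Both sides are conjugate linear in y, so the solutions still form a complex subspace, and
  -- elementary tensors suffice.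
  have : formsIn F (C.gr 1) ≤ ({
      carrier := {y | H.extend x (wedge (C.sgn ν) y) = H.extend x y * C.st ν}
      zero_mem' := by simp [extend_zero_right]
      add_mem' := fun {y y'} h h' => by
        simp only [Set.mem_ofPred_eq, map_add, extend_add_right, add_mul] at h h' ⊢
        rw [h, h']
      smul_mem' := fun c y h => by
        simp only [Set.mem_ofPred_eq] at h ⊢
        simp only [extend, map_smul, map_smulₛₗ, LinearMap.smul_apply, smul_mul_assoc] at h ⊢
        rw [h] } : Submodule ℂ (Forms C.base F)) := by
    refine Submodule.span_le.2 ?_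
    rintro _ ⟨η, hη, k, rfl⟩
    change H.extend x (wedge (C.sgn ν) (tmul C.base η k)) = H.extend x (tmul C.base η k) * C.st ν
    rw [wedge_tmul, extend_tmul_right, H.extend_tmul_right x η, C.st_mul_one_form _ hη, C.sgn_sgn,
      mul_assoc]
  exact this hy

/-- The graded Leibniz rule for the pairing `h_F` on `Ω ⊗_B F`. -/
theorem extend_leibniz (H : HermitianForm C F) {δ δ' : Ω →ₗ[ℂ] Ω}
    (hδ : ∀ ω η, δ (ω * η) = δ ω * η + C.sgn ω * δ η) (hst : ∀ ω, C.st (δ' ω) = δ (C.st ω))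
    {D D' : F → Forms C.base F} (hD' : ∀ f, D' f ∈ formsIn F (C.gr 1))
    (hH : ∀ f k : F, δ (H.h k f : Ω) =
      H.extend (D f) (tmul C.base 1 k) + H.extend (tmul C.base 1 f) (D' k))
    {T T' : Forms C.base F →ₗ[ℂ] Forms C.base F}
    (hT : ∀ ω f, T (tmul C.base ω f) = tmul C.base (δ ω) f + wedge (C.sgn ω) (D f))
    (hT' : ∀ ω f, T' (tmul C.base ω f) = tmul C.base (δ' ω) f + wedge (C.sgn ω) (D' f))
    (x y : Forms C.base F) :
    δ (H.extend x y) = H.extend (T x) y + H.extend (sgnF C.toDifferentialCalculus F x) (T' y) := by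
  induction x using forms_induction with
  | zero => simp [extend_zero_left]
  | add x x' hx hx' => simp only [map_add, extend_add_left, hx, hx']; abel
  | tmul ω f =>
    induction y using forms_induction with
    | zero => simp [extend_zero_right]
    | add y y' hy hy' => simp only [map_add, extend_add_right, hy, hy']; abel
    | tmul ν k =>
      have hb : C.sgn (H.h k f : Ω) = (H.h k f : Ω) := by
        rw [C.sgn_of_mem (H.h k f).2]; simp
      -- Pulling every form out of the first slot reduces all terms to the compatibility hypothesis
      -- on F.
      have hω : ∀ η, tmul C.base η f = wedge η (tmul C.base 1 f) := fun η => by simp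
      rw [hT, hT', sgnF_tmul, extend_add_left, extend_add_right, extend_tmul, extend_tmul,
        extend_tmul, extend_wedge_left, H.extend_tmul_right (D f), hω, extend_wedge_left,
        extend_wedge_sgn_right _ _ _ (hD' k), hδ, hδ, hH, C.sgn_mul, hb, hst]
      simp only [mul_add, add_mul, mul_assoc]
      abel

end Star

section Complex

variable {C : ComplexStructure Ω} [Module C.base F] [IsScalarTower ℂ C.base F]

theorem extend_tmul_one_mem (H : HermitianForm C.toStarCalculus F) {p : ℕ × ℕ} {x : Forms C.base F}
    (hx : x ∈ formsIn F (C.bi p)) (k : F) : H.extend x (tmul C.base 1 k) ∈ C.bi p := by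
  refine map_mem_of_mem_formsIn (u := H.twist _ _ (tmul C.base 1 k)) (fun ω hω f => ?_) hx
  change H.extend (tmul C.base ω f) (tmul C.base 1 k) ∈ C.bi p
  have h := C.bi_mul_mem hω (C.base_mem_bi (H.h k f))
  rw [show p + (0, 0) = p from add_zero p] at h
  rw [extend_tmul, C.st_one, mul_one]
  exact h

theorem extend_one_tmul_mem (H : HermitianForm C.toStarCalculus F) {a b : ℕ} {y : Forms C.base F}
    (hy : y ∈ formsIn F (C.bi (a, b))) (f : F) : H.extend (tmul C.base 1 f) y ∈ C.bi (b, a) := by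
  have : formsIn F (C.bi (a, b)) ≤
      ((C.bi (b, a)).comap ((H.twist (wedgeStar C.toStarCalculus)
        (fun ω ν b => by simp [wedgeStar, C.st_mul_base, mul_assoc])).flip (tmul C.base 1 f))) := by
    refine Submodule.span_le.2 ?_
    rintro _ ⟨ω, hω, k, rfl⟩
    change H.extend (tmul C.base 1 f) (tmul C.base ω k) ∈ C.bi (b, a)
    have h := C.bi_mul_mem (C.base_mem_bi (H.h k f)) (C.st_bi hω)
    rw [show ((0, 0) : ℕ × ℕ) + (b, a) = (b, a) from zero_add _] at h
    rw [extend_tmul, one_mul]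
    exact h
  exact this hy

/-- The two components of the compatibility of a Chern connection with `h_F`. -/
theorem chern_components {H : HermitianForm C.toStarCalculus F} {E : HolomorphicStructure C F}
    {N : Connection C.toDifferentialCalculus F} (hN : IsChernConnection H E N) (f k : F) :
    C.del (H.h k f : Ω) = H.extend (N.toFun f - E.toFun f) (tmul C.base 1 k) +
        H.extend (tmul C.base 1 f) (E.toFun k) ∧
      C.dbar (H.h k f : Ω) = H.extend (E.toFun f) (tmul C.base 1 k) +
        H.extend (tmul C.base 1 f) (N.toFun k - E.toFun k) := by
  have h := hN.1 f k
  have hb := C.base_mem_bi (H.h k f)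
  -- The second slot of h_F is starred: the (0,1)-part of ∇k contributes in bidegree (1,0), and the
  -- (1,0)-part in bidegree (0,1).
  refine C.eq_of_add_eq_add (p := (1, 0)) (q := (0, 1)) (by simp) (C.del_mem hb)
    (add_mem (H.extend_tmul_one_mem (hN.2 f) k) (H.extend_one_tmul_mem (E.mem k) f))
    (C.dbar_mem hb)
    (add_mem (H.extend_tmul_one_mem (E.mem f) k) (H.extend_one_tmul_mem (hN.2 k) f)) ?_
  rw [C.del_add_dbar, h]
  have e : ∀ g, N.toFun g = (N.toFun g - E.toFun g) + E.toFun g := fun g => by abel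
  conv_lhs => rw [e f, e k, extend_add_left, extend_add_right]
  abel

end Complex

end HermitianForm

variable {Ω : Type*} [Ring Ω] [Algebra ℂ Ω] {n : ℕ} {F : Type*} [AddCommGroup F] [Module ℂ F]

/-! ### The Hodge map and primitive forms with values in F -/

section Hodge

variable (K : KahlerStructure Ω n) [Module K.base F]

variable (F) in
/-- The Hodge map `∗ ⊗ id` of `Ω ⊗_B F`. -/
def hodgeF : Forms K.base F →ₗ[ℂ] Forms K.base F := formsMap F K.hodge K.hodge_mul_base

@[simp]
theorem hodgeF_tmul (ω : Ω) (f : F) :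
    hodgeF F K (tmul K.base ω f) = tmul K.base (K.hodge ω) f := rfl

theorem hodgeF_hodgeF (x : Forms K.base F) :
    hodgeF F K (hodgeF F K x) = sgnF K.toDifferentialCalculus F x := by
  induction x using forms_induction with
  | zero => simp
  | add x y hx hy => simp only [map_add, hx, hy]
  | tmul ω f => rw [hodgeF_tmul, hodgeF_tmul, K.hodge_hodge, sgnF_tmul]

/-- The coefficient of `L^{n-j-a-b} α` in `∗ (L^j α)`, for primitive `α` of bidegree `(a,b)`. -/
def hodgeCoeff (n a b j : ℕ) : ℂ :=
  (-1 : ℂ) ^ ((a + b) * (a + b + 1) / 2) * Complex.I ^ ((a : ℤ) - (b : ℤ)) *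
    ((j.factorial : ℂ) / ((n - j - (a + b)).factorial : ℂ))

theorem hodgeF_wedge {a b j : ℕ} (hj : j + (a + b) ≤ n) {x : Forms K.base F}
    (hx : x ∈ formsIn F (K.primitive (a, b))) : hodgeF F K (wedge (K.κ ^ j) x) =
      hodgeCoeff n a b j • wedge (K.κ ^ (n - j - (a + b))) x := by
  refine eqOn_formsIn (u := hodgeF F K ∘ₗ wedge (K.κ ^ j))
    (v := hodgeCoeff n a b j • wedge (K.κ ^ (n - j - (a + b)))) (fun ω hω f => ?_) hx
  rw [LinearMap.comp_apply, wedge_tmul, hodgeF_tmul, K.hodge_spec a b j hj ω hω, tmul_smul_left]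
  rfl

theorem wedge_one (x : Forms K.base F) : wedge (1 : Ω) x = x := by
  induction x using forms_induction with
  | zero => simp
  | add x y hx hy => rw [map_add, hx, hy]
  | tmul ω f => simp

theorem hodgeF_of_primitive {a b : ℕ} (hj : a + b ≤ n) {x : Forms K.base F}
    (hx : x ∈ formsIn F (K.primitive (a, b))) : hodgeF F K x =
      hodgeCoeff n a b 0 • wedge (K.κ ^ (n - (a + b))) x := by
  have h := hodgeF_wedge K (j := 0) (by omega) hx
  rwa [pow_zero, wedge_one, Nat.sub_zero] at h

theorem wedge_pow_eq_zero {a b j : ℕ} (hj : n + 1 ≤ j + (a + b)) {x : Forms K.base F}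
    (hx : x ∈ formsIn F (K.primitive (a, b))) : wedge (K.κ ^ j) x = 0 := by
  refine eqOn_formsIn (u := wedge (K.κ ^ j)) (v := 0) (fun ω hω f => ?_) hx
  have e : j = (j - (n + 1 - (a + b))) + (n + 1 - (a + b)) := by omega
  have h : K.κ ^ j * ω = 0 := by
    rw [e, pow_add, mul_assoc, (KahlerStructure.mem_primitive.1 hω).2, mul_zero]
  rw [wedge_tmul, h]
  simp [tmul]

theorem formsIn_eq_bot {p : ℕ × ℕ} (hp : n < p.1 ∨ n < p.2) :
    formsIn (B := K.base) F (K.bi p) = ⊥ := by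
  rw [K.bi_eq_bot hp, formsIn_bot]

theorem formsIn_one_succ (k : ℕ) {x : Forms K.base F} (hx : x ∈ formsIn F (K.bi (1, k + 1))) :
    ∃ x₀ ∈ formsIn F (K.primitive (1, k + 1)), ∃ x₁ ∈ formsIn F (K.bi (0, k)),
      x = x₀ + wedge K.κ x₁ := by
  have : formsIn (B := K.base) F (K.bi (1, k + 1)) ≤
      formsIn F (K.primitive (1, k + 1)) ⊔ (formsIn F (K.bi (0, k))).map (wedge K.κ) := by
    refine Submodule.span_le.2 ?_
    rintro _ ⟨ω, hω, f, rfl⟩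
    obtain ⟨ω₀, h₀, ω₁, h₁, rfl⟩ := K.bi_one_succ k hω
    rw [tmul_add_left]
    exact Submodule.add_mem_sup (tmul_mem_formsIn h₀ f) ⟨_, tmul_mem_formsIn h₁ f, rfl⟩
  obtain ⟨x₀, h₀, _, ⟨x₁, h₁, rfl⟩, h⟩ := Submodule.mem_sup.1 (this hx)
  exact ⟨x₀, h₀, x₁, h₁, h.symm⟩

end Hodge

/-! ### Commutation with κ and the curvature equation -/

section Commute

variable {K : KahlerStructure Ω n} [Module K.base F]

/-- The form κ has even degree, and being closed it is killed by ∂̄, by comparison of bidegrees. -/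
theorem extend_wedge_κ_pow (E : ZeroOneConnection K.toComplexStructure F) (j : ℕ)
    (x : Forms K.base F) : E.extend (wedge (K.κ ^ j) x) = wedge (K.κ ^ j) (E.extend x) := by
  induction j with
  | zero => rw [pow_zero, wedge_one, wedge_one]
  | succ j ih =>
    rw [pow_succ', wedge_mul, wedge_mul, ← ih]
    refine (extendConn_wedge K.dbar_mul _ _).trans ?_
    rw [K.del_κ.2, K.sgn_κ, map_zero, LinearMap.zero_apply, zero_add]
    rfl

theorem delConn_wedge_κ_pow (N : Connection K.toDifferentialCalculus F)
    (E : ZeroOneConnection K.toComplexStructure F) (j : ℕ) (x : Forms K.base F) :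
    delConn N E (wedge (K.κ ^ j) x) = wedge (K.κ ^ j) (delConn N E x) := by
  induction j with
  | zero => rw [pow_zero, wedge_one, wedge_one]
  | succ j ih =>
    rw [pow_succ', wedge_mul, wedge_mul, ← ih]
    refine (extendConn_wedge K.del_mul _ _).trans ?_
    rw [K.del_κ.1, K.sgn_κ, map_zero, LinearMap.zero_apply, zero_add]
    rfl

theorem curvature_extend {N : Connection K.toDifferentialCalculus F} {c : ℂ}
    (hN : ∀ f : F, N.curvature f = c • tmul K.base K.κ f) (x : Forms K.base F) :
    N.extend (N.extend x) = c • wedge K.κ x := by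
  induction x using forms_induction with
  | zero => simp
  | add x y hx hy => simp only [map_add, hx, hy, smul_add]
  | tmul ω f =>
    refine (extendConn_extendConn (hδ := K.d_mul_base) (D := N.toFun) (hD := N.leibniz)
      K.d_mul_eq K.sgn_d K.d_d ω f).trans ?_
    change wedge ω (N.curvature f) = _
    rw [hN, map_smul, wedge_tmul, wedge_tmul, K.κ_central]

/-- The `(1,1)`-component of the curvature equation. -/
theorem delConn_extend_add {N : Connection K.toDifferentialCalculus F}
    {E : HolomorphicStructure K.toComplexStructure F}
    (hNE : ∀ f : F, N.toFun f - E.toFun f ∈ formsIn F (K.bi (1, 0))) {c : ℂ}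
    (hN : ∀ f : F, N.curvature f = c • tmul K.base K.κ f) {a b : ℕ} {x : Forms K.base F}
    (hx : x ∈ formsIn F (K.bi (a, b))) :
    delConn N E.toZeroOneConnection (E.extend x) + E.extend (delConn N E.toZeroOneConnection x) =
      c • wedge K.κ x := by
  have h := curvature_extend hN x
  rw [← delConn_add_extend N E.toZeroOneConnection x, map_add,
    ← delConn_add_extend N E.toZeroOneConnection, ← delConn_add_extend N E.toZeroOneConnection,
    E.extend_extend, add_zero] at h
  have m1 := delConn_mem hNE (delConn_mem hNE hx)
  have m2 := E.extend_mem (delConn_mem hNE hx)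
  have m3 := delConn_mem hNE (E.extend_mem hx)
  have m4 : wedge K.κ x ∈ formsIn F (K.bi (a + 1, b + 1)) := by
    have := wedge_mem (T := K.bi ((1, 1) + (a, b))) (fun η hη => K.bi_mul_mem K.κ_mem hη) hx
    rwa [show ((1, 1) : ℕ × ℕ) + (a, b) = (a + 1, b + 1) by ext <;> simp [add_comm]] at this
  -- Since ∂̄_F² = 0, the only other term of ∇² is ∂_F², which lies in bidegree (a+2,b) and is
  -- removed by the projection.
  have h1 := congrArg (projF K.toComplexStructure F (a + 1, b + 1)) h
  simp only [map_add, map_smul] at h1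
  rw [projF_of_mem_ne (by simp) m1, projF_of_mem m2, projF_of_mem m3, projF_of_mem m4,
    zero_add] at h1
  rw [add_comm, h1]

end Commute

/-! ### The inner product as an integral, and adjoints via Stokes -/

section Inner

variable {K : KahlerStructure Ω n} [Module K.base F] [IsScalarTower ℂ K.base F] {φ : K.State}
  {H : HermitianForm K.toStarCalculus F}

theorem innerF_add_left (x x' y : Forms K.base F) :
    innerF K φ H (x + x') y = innerF K φ H x y + innerF K φ H x' y := by simp [innerF]

theorem innerF_add_right (x y y' : Forms K.base F) :
    innerF K φ H x (y + y') = innerF K φ H x y + innerF K φ H x y' := by simp [innerF]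

theorem innerF_smul_left (c : ℂ) (x y : Forms K.base F) :
    innerF K φ H (c • x) y = c * innerF K φ H x y := by simp [innerF]

theorem innerF_smul_right (c : ℂ) (x y : Forms K.base F) :
    innerF K φ H x (c • y) = starRingEnd ℂ c * innerF K φ H x y := by simp [innerF]

theorem innerF_zero_left (y : Forms K.base F) : innerF K φ H 0 y = 0 := by simp [innerF]

theorem innerF_zero_right (x : Forms K.base F) : innerF K φ H x 0 = 0 := by simp [innerF]

/-- This form of the inner product is what Stokes' theorem acts on; it needs ∗ to commute with the
involution. -/
theorem innerF_eq_integral (x y : Forms K.base F) :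
    innerF K φ H x y = K.integral φ (H.extend x (hodgeF F K y)) := by
  induction x using forms_induction with
  | zero => rw [innerF_zero_left, H.extend_zero_left, map_zero]
  | add x x' hx hx' => rw [innerF_add_left, H.extend_add_left, map_add, hx, hx']
  | tmul ω f =>
    induction y using forms_induction with
    | zero => rw [innerF_zero_right, map_zero, H.extend_zero_right, map_zero]
    | add y y' hy hy' => rw [innerF_add_right, map_add, H.extend_add_right, map_add, hy, hy']
    | tmul ν k =>
      rw [hodgeF_tmul, H.extend_tmul, ← K.hodge_st]
      rfl

/-- The two integrands differ by the sign operator applied to the whole form, which the integral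
does not see. -/
theorem integral_extend_sgn (x y : Forms K.base F) :
    K.integral φ (H.extend (sgnF K.toDifferentialCalculus F x) y) =
      K.integral φ (H.extend x (sgnF K.toDifferentialCalculus F y)) := by
  induction x using forms_induction with
  | zero => simp [H.extend_zero_left]
  | add x x' hx hx' => simp only [map_add, H.extend_add_left, hx, hx']
  | tmul ω f =>
    induction y using forms_induction with
    | zero => simp [H.extend_zero_right]
    | add y y' hy hy' => simp only [map_add, H.extend_add_right, hy, hy']
    | tmul ν k =>
      have hb : K.sgn (H.h k f : Ω) = (H.h k f : Ω) := by
        rw [K.sgn_of_mem (H.h k f).2]; simp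
      rw [sgnF_tmul, sgnF_tmul, H.extend_tmul, H.extend_tmul, ← K.integral_sgn]
      simp only [K.sgn_mul, K.sgn_sgn, hb, K.sgn_st]

/-- Stokes' theorem turns a Leibniz rule for the pairing into an adjunction. -/
theorem isAdjoint_of_leibniz {δ : Ω →ₗ[ℂ] Ω} {T T' : Forms K.base F →ₗ[ℂ] Forms K.base F}
    (hδ : ∀ ω, K.integral φ (δ ω) = 0)
    (h : ∀ x y : Forms K.base F, δ (H.extend x y) =
      H.extend (T x) y + H.extend (sgnF K.toDifferentialCalculus F x) (T' y)) :
    IsAdjoint K φ H T (-(hodgeF F K ∘ₗ T' ∘ₗ hodgeF F K)) := by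
  intro x y
  -- Stokes is applied to h_F(x, ∗y). The sign on x then moves to T'∗y, where it becomes ∗∗, and one
  -- of these two stars is absorbed into the inner product.
  have h1 := hδ (H.extend x (hodgeF F K y))
  rw [h, map_add, integral_extend_sgn, ← hodgeF_hodgeF, ← innerF_eq_integral] at h1
  rw [innerF_eq_integral x, eq_neg_of_add_eq_zero_left h1, LinearMap.neg_apply, map_neg,
    H.extend_neg_right, map_neg]
  rfl

variable {E : HolomorphicStructure K.toComplexStructure F}
  {N : Connection K.toDifferentialCalculus F}

theorem isAdjoint_extend (hφ : K.ClosedIntegral φ) (hN : IsChernConnection H E N) :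
    IsAdjoint K φ H E.extend
      (-(hodgeF F K ∘ₗ delConn N E.toZeroOneConnection ∘ₗ hodgeF F K)) :=
  isAdjoint_of_leibniz (K.integral_dbar hφ) <|
    H.extend_leibniz K.dbar_mul K.st_del (D := E.toFun) (D' := fun f => N.toFun f - E.toFun f)
      (fun f => formsIn_mono (K.bi_le (1, 0)) (hN.2 f))
      (fun f k => (HermitianForm.chern_components hN f k).2) (fun _ _ => rfl) (fun _ _ => rfl)

theorem isAdjoint_delConn (hφ : K.ClosedIntegral φ) (hN : IsChernConnection H E N) :
    IsAdjoint K φ H (delConn N E.toZeroOneConnection)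
      (-(hodgeF F K ∘ₗ E.extend ∘ₗ hodgeF F K)) :=
  isAdjoint_of_leibniz (K.integral_del hφ) <|
    H.extend_leibniz K.del_mul K.st_dbar (D := fun f => N.toFun f - E.toFun f) (D' := E.toFun)
      (fun f => formsIn_mono (K.bi_le (0, 1)) (E.mem f))
      (fun f k => (HermitianForm.chern_components hN f k).1) (fun _ _ => rfl) (fun _ _ => rfl)

theorem innerF_self_im (hpos : InnerPosDef K φ H) (x : Forms K.base F) :
    (innerF K φ H x x).im = 0 := by
  by_cases h : x = 0
  · rw [h, innerF_zero_left]; rfl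
  · exact (hpos x h).1

theorem innerF_self_nonneg (hpos : InnerPosDef K φ H) (x : Forms K.base F) :
    0 ≤ (innerF K φ H x x).re := by
  by_cases h : x = 0
  · rw [h, innerF_zero_left]; rfl
  · exact (hpos x h).2.le

/-- Polarisation: a sesquilinear form that is real on the diagonal is Hermitian, by evaluation at x
+ y and x + iy. -/
theorem innerF_conj (hpos : InnerPosDef K φ H) (x y : Forms K.base F) :
    starRingEnd ℂ (innerF K φ H x y) = innerF K φ H y x := by
  have h1 := innerF_self_im hpos (x + y)
  have h2 := innerF_self_im hpos (x + Complex.I • y)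
  simp only [innerF_add_left, innerF_add_right, innerF_smul_left, innerF_smul_right] at h1 h2
  have hx := innerF_self_im hpos x
  have hy := innerF_self_im hpos y
  simp at h1 h2
  apply Complex.ext
  · simp; linarith
  · simp; linarith

theorem isAdjoint_right (hpos : InnerPosDef K φ H) {T S : Forms K.base F →ₗ[ℂ] Forms K.base F}
    (h : IsAdjoint K φ H T S) (x y : Forms K.base F) :
    innerF K φ H x (T y) = innerF K φ H (S x) y := by
  rw [← innerF_conj hpos, h, innerF_conj hpos]

theorem eq_zero_of_innerF (hpos : InnerPosDef K φ H) {x : Forms K.base F}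
    (h : innerF K φ H x x = 0) : x = 0 := by
  by_contra hx
  have := (hpos x hx).2
  rw [h] at this
  exact lt_irrefl _ this

/-- Positive definiteness makes adjoints unique, so the chosen adjoint can be replaced by an
explicit formula. -/
theorem adjointF_eq (hpos : InnerPosDef K φ H) {T S : Forms K.base F →ₗ[ℂ] Forms K.base F}
    (h : IsAdjoint K φ H T S) : adjointF K φ H T = S := by
  have hT : IsAdjointable K φ H T := ⟨S, h⟩
  have hc : IsAdjoint K φ H T (adjointF K φ H T) := by
    rw [adjointF, dif_pos hT]; exact hT.choose_spec
  refine LinearMap.ext fun y => ?_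
  refine sub_eq_zero.1 (eq_zero_of_innerF hpos ?_)
  rw [sub_eq_add_neg, ← neg_one_smul ℂ (S _)]
  conv_lhs => rw [innerF_add_right, innerF_smul_right, ← hc, ← h]
  simp

theorem adjoint_comp_self_eq_zero (hpos : InnerPosDef K φ H)
    {T S : Forms K.base F →ₗ[ℂ] Forms K.base F} (h : IsAdjoint K φ H T S)
    (hT : ∀ x, T (T x) = 0) (x : Forms K.base F) : S (S x) = 0 := by
  refine eq_zero_of_innerF hpos ?_
  rw [← h, ← h, hT, innerF_zero_left]

end Inner

/-! ### Constants of the Kähler identities -/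

theorem neg_one_pow_triangle (m : ℕ) :
    (-1 : ℂ) ^ ((m + 1) * (m + 1 + 1) / 2) * (-1) ^ (m * (m + 1) / 2) = (-1) ^ (m + 1) := by
  have e : (m + 1) * (m + 1 + 1) / 2 = m * (m + 1) / 2 + (m + 1) := by
    rw [show (m + 1) * (m + 1 + 1) = m * (m + 1) + (m + 1) * 2 by ring,
      Nat.add_mul_div_right _ _ two_pos]
  rw [e, pow_add, mul_right_comm, ← mul_pow]
  simp

/-- This is the constant collected by ∗∂_F∗ on bidegree (0, m+1): the first ∗ contributes 1/(n-m-1)!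
and the second (n-m)!. The triangular signs combine to (-1)^{m+1}, which cancels against i^{-2m-1} =
(-1)^{m+1} i. -/
theorem hodgeCoeff_mul_zero {n m : ℕ} (hm : m + 1 ≤ n) :
    hodgeCoeff n 0 (m + 1) 0 * hodgeCoeff n 0 m (n - m) = Complex.I * (n - m : ℕ) := by
  have h1 : (n - m).factorial = (n - m) * (n - (m + 1)).factorial := by
    rw [show n - m = (n - (m + 1)) + 1 by omega, Nat.factorial_succ]
  have h2 : ((n - (m + 1)).factorial : ℂ) ≠ 0 := by exact_mod_cast Nat.factorial_ne_zero _
  have hs := neg_one_pow_triangle m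
  have hI : Complex.I ^ ((0 : ℤ) - (m + 1 : ℕ)) * Complex.I ^ ((0 : ℤ) - m) =
      (-1) ^ (m + 1) * Complex.I := by
    rw [← zpow_add₀ Complex.I_ne_zero,
      show (0 : ℤ) - (m + 1 : ℕ) + (0 - m) = -(2 * (m + 1 : ℕ) : ℤ) + 1 by push_cast; ring,
      zpow_add₀ Complex.I_ne_zero, zpow_neg, zpow_mul, zpow_one, zpow_natCast]
    congr 1
    rw [show Complex.I ^ (2 : ℤ) = -1 by exact_mod_cast Complex.I_sq, ← inv_pow]
    norm_num
  have hss : (-1 : ℂ) ^ (m + 1) * (-1) ^ (m + 1) = 1 := by rw [← mul_pow]; simp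
  simp only [hodgeCoeff, zero_add, Nat.sub_zero, Nat.factorial_zero, Nat.cast_one,
    show n - (n - m) - m = 0 by omega, h1, Nat.cast_mul, Nat.cast_zero]
  generalize ((n - (m + 1)).factorial : ℂ) = f at *
  generalize ((n - m : ℕ) : ℂ) = N at *
  have key := congrArg₂ (· * ·) hs hI
  simp only [← mul_assoc, hss, one_mul] at key
  field_simp
  linear_combination N * key

/-- This is the constant for ∗∂̄_F∗ on primitive forms of bidegree (1,k). The power of i is now
i^{1-2k}; the shift by two in the exponent accounts for the opposite sign in the two Kähler
identities. -/
theorem hodgeCoeff_mul_one {n k : ℕ} (hk : k < n) :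
    hodgeCoeff n 1 k 0 * hodgeCoeff n 0 k (n - k) = -(Complex.I * (n - k : ℕ)) := by
  have h1 : (n - k).factorial = (n - k) * (n - (k + 1)).factorial := by
    rw [show n - k = (n - (k + 1)) + 1 by omega, Nat.factorial_succ]
  have h2 : ((n - (k + 1)).factorial : ℂ) ≠ 0 := by exact_mod_cast Nat.factorial_ne_zero _
  have hs := neg_one_pow_triangle k
  have hI : Complex.I ^ ((1 : ℤ) - k) * Complex.I ^ ((0 : ℤ) - k) =
      (-1) ^ k * Complex.I := by
    rw [← zpow_add₀ Complex.I_ne_zero,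
      show (1 : ℤ) - k + (0 - k) = -(2 * k : ℤ) + 1 by ring,
      zpow_add₀ Complex.I_ne_zero, zpow_neg, zpow_mul, zpow_one, zpow_natCast]
    congr 1
    rw [show Complex.I ^ (2 : ℤ) = -1 by exact_mod_cast Complex.I_sq, ← inv_pow]
    norm_num
  have hss : (-1 : ℂ) ^ k * (-1) ^ k = 1 := by rw [← mul_pow]; simp
  simp only [hodgeCoeff, zero_add, Nat.sub_zero, Nat.factorial_zero, Nat.cast_one,
    show n - (n - k) - k = 0 by omega, h1, Nat.cast_mul, Nat.cast_zero, add_comm 1 k]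
  generalize ((n - (k + 1)).factorial : ℂ) = f at *
  generalize ((n - k : ℕ) : ℂ) = N at *
  have key := congrArg₂ (· * ·) hs hI
  simp only [pow_succ _ k, ← mul_assoc, mul_right_comm _ (-1 : ℂ), hss, one_mul] at key
  field_simp
  linear_combination N * key

/-! ### Kähler identities for the codifferentials -/

section Codifferential

variable {K : KahlerStructure Ω n} [Module K.base F]
  (N : Connection K.toDifferentialCalculus F) (E : ZeroOneConnection K.toComplexStructure F)

/-- The operator `-∗ ∂_F ∗`. -/
def dbarAdj : Forms K.base F →ₗ[ℂ] Forms K.base F :=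
  -(hodgeF F K ∘ₗ delConn N E ∘ₗ hodgeF F K)

/-- The operator `-∗ ∂̄_F ∗`. -/
def delAdj : Forms K.base F →ₗ[ℂ] Forms K.base F :=
  -(hodgeF F K ∘ₗ E.extend ∘ₗ hodgeF F K)

variable {N E}

theorem formsIn_zero_le_primitive (k : ℕ) :
    formsIn (B := K.base) F (K.bi (0, k)) ≤ formsIn F (K.primitive (0, k)) :=
  formsIn_mono (K.bi_zero_le_primitive k)

/-- The Kähler identity `∂̄_F^† = -i [Λ, ∂_F]` on forms of bidegree `(0, m + 1)`. -/
theorem dbarAdj_eq {m : ℕ} (hm : m + 1 ≤ n) {x x₀ x₁ : Forms K.base F}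
    (hx : x ∈ formsIn F (K.bi (0, m + 1))) (h₀ : x₀ ∈ formsIn F (K.primitive (1, m + 1)))
    (h₁ : x₁ ∈ formsIn F (K.bi (0, m))) (h : delConn N E x = x₀ + wedge K.κ x₁) :
    dbarAdj N E x = -(Complex.I * (n - m : ℕ)) • x₁ := by
  have e : wedge (K.κ ^ (n - (0 + (m + 1)))) (wedge K.κ x₁) = wedge (K.κ ^ (n - m)) x₁ := by
    rw [← wedge_mul, ← pow_succ, show n - (0 + (m + 1)) + 1 = n - m by omega]
  simp only [dbarAdj, LinearMap.neg_apply, LinearMap.comp_apply]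
  -- After the first ∗ the power κ^{n-m-1} stands in front; it is exactly the power that kills the
  -- primitive part x₀ of degree m + 2. The second ∗ then removes κ^{n-m} from x₁.
  rw [hodgeF_of_primitive K (by omega) (formsIn_zero_le_primitive _ hx), map_smul,
    delConn_wedge_κ_pow, h, map_add, wedge_pow_eq_zero K (by omega) h₀, zero_add, e, map_smul,
    hodgeF_wedge K (by omega) (formsIn_zero_le_primitive _ h₁), smul_smul, hodgeCoeff_mul_zero hm,
    show n - (n - m) - (0 + m) = 0 by omega, pow_zero, wedge_one, neg_smul]

/-- On degree zero ∗x is a multiple of κⁿ x, and κⁿ kills the form ∂_F x, which is primitive of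
degree one. -/
theorem dbarAdj_zero (hN : ∀ f : F, N.toFun f - E.toFun f ∈ formsIn F (K.bi (1, 0)))
    {x : Forms K.base F} (hx : x ∈ formsIn F (K.bi (0, 0))) : dbarAdj N E x = 0 := by
  have h := formsIn_mono K.bi_one_zero_le_primitive (delConn_mem hN hx)
  simp only [dbarAdj, LinearMap.neg_apply, LinearMap.comp_apply]
  rw [hodgeF_of_primitive K (by omega) (formsIn_zero_le_primitive _ hx), map_smul,
    delConn_wedge_κ_pow, wedge_pow_eq_zero K (by omega) h, smul_zero, map_zero, neg_zero]

theorem dbarAdj_mem (hN : ∀ f : F, N.toFun f - E.toFun f ∈ formsIn F (K.bi (1, 0))) {m : ℕ}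
    {x : Forms K.base F} (hx : x ∈ formsIn F (K.bi (0, m + 1))) :
    dbarAdj N E x ∈ formsIn F (K.bi (0, m)) := by
  by_cases hm : m + 1 ≤ n
  · obtain ⟨x₀, h₀, x₁, h₁, h⟩ := formsIn_one_succ K m (delConn_mem hN hx)
    rw [dbarAdj_eq hm hx h₀ h₁ h]
    exact Submodule.smul_mem _ _ h₁
  · rw [formsIn_eq_bot K (Or.inr (by simp; omega)), Submodule.mem_bot] at hx
    rw [hx, map_zero]
    exact zero_mem _

/-- The Kähler identity `∂_F^† = i [Λ, ∂̄_F]` on primitive forms of bidegree `(1, k)`. -/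
theorem delAdj_eq {k : ℕ} (hk : k < n) {x x₀ x₁ : Forms K.base F}
    (hx : x ∈ formsIn F (K.primitive (1, k))) (h₀ : wedge (K.κ ^ (n - (1 + k))) x₀ = 0)
    (h₁ : x₁ ∈ formsIn F (K.bi (0, k))) (h : E.extend x = x₀ + wedge K.κ x₁) :
    delAdj E x = (Complex.I * (n - k : ℕ)) • x₁ := by
  have e : wedge (K.κ ^ (n - (1 + k))) (wedge K.κ x₁) = wedge (K.κ ^ (n - k)) x₁ := by
    rw [← wedge_mul, ← pow_succ, show n - (1 + k) + 1 = n - k by omega]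
  simp only [delAdj, LinearMap.neg_apply, LinearMap.comp_apply]
  rw [hodgeF_of_primitive K (by omega) hx, map_smul,
    extend_wedge_κ_pow, h, map_add, h₀, zero_add, e, map_smul,
    hodgeF_wedge K (by omega) (formsIn_zero_le_primitive _ h₁), smul_smul, hodgeCoeff_mul_one hk,
    show n - (n - k) - (0 + k) = 0 by omega, pow_zero, wedge_one, neg_smul, neg_neg]

/-- This treats k = 0 uniformly, with x₁ = 0. Recording the bidegree of ∂̄_F x₁ instead of that of
x₁ avoids the index k - 1. -/
theorem exists_delConn_decomposition
    (hN : ∀ f : F, N.toFun f - E.toFun f ∈ formsIn F (K.bi (1, 0))) {k : ℕ} (hk : k ≤ n)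
    {x : Forms K.base F} (hx : x ∈ formsIn F (K.bi (0, k))) :
    ∃ x₀ ∈ formsIn F (K.primitive (1, k)), ∃ x₁, E.extend x₁ ∈ formsIn F (K.bi (0, k)) ∧
      delConn N E x = x₀ + wedge K.κ x₁ ∧
      dbarAdj N E x = -(Complex.I * (n - k + 1 : ℕ)) • x₁ := by
  cases k with
  | zero =>
    refine ⟨_, formsIn_mono K.bi_one_zero_le_primitive (delConn_mem hN hx), 0, ?_, ?_, ?_⟩
    · rw [map_zero]; exact zero_mem _
    · rw [map_zero, add_zero]
    · rw [dbarAdj_zero hN hx, smul_zero]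
  | succ m =>
    obtain ⟨x₀, h₀, x₁, h₁, h⟩ := formsIn_one_succ K m (delConn_mem hN hx)
    refine ⟨x₀, h₀, x₁, E.extend_mem h₁, h, ?_⟩
    rw [dbarAdj_eq hk hx h₀ h₁ h, show n - (m + 1) + 1 = n - m by omega]

end Codifferential

/-! ### The Nakano estimate -/

section Estimate

variable {K : KahlerStructure Ω n} [Module K.base F] [IsScalarTower ℂ K.base F] {φ : K.State}
  {H : HermitianForm K.toStarCalculus F} {E : HolomorphicStructure K.toComplexStructure F}
  {N : Connection K.toDifferentialCalculus F}

/-- Multiplication by κ can be moved across h_F, and ∗x₀ is a multiple of κ^{n-k-1} x₀; one more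
factor κ kills it. -/
theorem innerF_wedge_primitive {k : ℕ} (hk : k < n) {x₀ : Forms K.base F}
    (h₀ : x₀ ∈ formsIn F (K.primitive (1, k))) (x₁ : Forms K.base F) :
    innerF K φ H (wedge K.κ x₁) x₀ = 0 := by
  have h : ∀ y z : Forms K.base F, H.extend (wedge K.κ y) z = H.extend y (wedge K.κ z) := by
    intro y z
    rw [H.extend_wedge_left]
    induction z using forms_induction with
    | zero => simp [H.extend_zero_right]
    | add z z' hz hz' => simp only [map_add, H.extend_add_right, mul_add, hz, hz']
    | tmul ν f =>
      have := K.st_κ_pow_mul 1 ν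
      rw [pow_one] at this
      rw [wedge_tmul, H.extend_tmul_right, H.extend_tmul_right y (K.κ * ν), this, ← mul_assoc,
        K.κ_central, mul_assoc]
  rw [innerF_eq_integral, hodgeF_of_primitive K (by omega) h₀, h, map_smul, ← wedge_mul,
    ← pow_succ', wedge_pow_eq_zero K (by omega) h₀, smul_zero, H.extend_zero_right, map_zero]

/-- The Nakano type estimate on forms of bidegree `(0, k)`, `k < n`. -/
theorem nakano_estimate (hφ : K.ClosedIntegral φ) (hpos : InnerPosDef K φ H)
    (hN : IsChernConnection H E N) {θ : ℝ}
    (hθ : ∀ f : F, N.curvature f = ((θ : ℂ) * Complex.I) • tmul K.base K.κ f) {k : ℕ} (hk : k < n)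
    {x : Forms K.base F} (hx : x ∈ formsIn F (K.bi (0, k))) :
    θ * (n - k : ℕ) * (innerF K φ H x x).re ≤ (innerF K φ H (E.extend x) (E.extend x)).re +
      (innerF K φ H (dbarAdj N E.toZeroOneConnection x)
        (dbarAdj N E.toZeroOneConnection x)).re := by
  obtain ⟨γ₀, hγ₀, γ₁, hγ₁, hγ, hSx⟩ := exists_delConn_decomposition hN.2 hk.le hx
  have hEx := E.extend_mem hx
  obtain ⟨δ₀, hδ₀, δ₁, hδ₁, hδ⟩ := formsIn_one_succ K k (delConn_mem hN.2 hEx)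
  have hSEx := dbarAdj_eq (by omega) hEx hδ₀ hδ₁ hδ
  have hcurv := delConn_extend_add hN.2 hθ hx
  rw [hδ, hγ, map_add] at hcurv
  have hκ := extend_wedge_κ_pow E.toZeroOneConnection 1 γ₁
  rw [pow_one] at hκ
  rw [hκ] at hcurv
  -- The curvature equation is solved for ∂̄_F γ₀: its κ-coefficient is ε, and the remainder -δ₀ is
  -- killed by the power of κ that enters ∂_F†γ₀.
  set ε := ((θ : ℂ) * Complex.I) • x - δ₁ - E.extend γ₁ with hε
  have hεm : ε ∈ formsIn F (K.bi (0, k)) :=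
    sub_mem (sub_mem (Submodule.smul_mem _ _ hx) hδ₁) hγ₁
  have hEγ : E.extend γ₀ = -δ₀ + wedge K.κ ε := by
    rw [hε, map_sub, map_sub, map_smul, ← hcurv]; abel
  have hdel := delAdj_eq hk hγ₀
    (by rw [map_neg, wedge_pow_eq_zero K (by omega) hδ₀, neg_zero]) hεm hEγ
  have hadjE : IsAdjoint K φ H E.extend (dbarAdj N E.toZeroOneConnection) := isAdjoint_extend hφ hN
  have hadjD : IsAdjoint K φ H (delConn N E.toZeroOneConnection) (delAdj E.toZeroOneConnection) :=
    isAdjoint_delConn hφ hN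
  -- The source of positivity: ⟨x, ∂_F†γ₀⟩ = ⟨∂_F x, γ₀⟩ = ‖γ₀‖², as κ∧γ₁ is orthogonal to γ₀.
  have i1 : innerF K φ H x (delAdj E.toZeroOneConnection γ₀) = innerF K φ H γ₀ γ₀ := by
    rw [← hadjD, hγ, innerF_add_left, innerF_wedge_primitive hk hγ₀, add_zero]
  have i2 := hadjE x (E.extend x)
  have i3 := isAdjoint_right hpos hadjE x (dbarAdj N E.toZeroOneConnection x)
  rw [hdel, innerF_smul_right] at i1
  rw [hSEx, innerF_smul_right] at i2
  have hS2 : E.extend (dbarAdj N E.toZeroOneConnection x) =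
      -(Complex.I * (n - k + 1 : ℕ)) • E.extend γ₁ := by rw [hSx, map_smul]
  rw [hS2, innerF_smul_right] at i3
  have i4 : innerF K φ H x ε = starRingEnd ℂ ((θ : ℂ) * Complex.I) * innerF K φ H x x -
      innerF K φ H x δ₁ - innerF K φ H x (E.extend γ₁) := by
    have e : ((θ : ℂ) * Complex.I) • x = ε + δ₁ + E.extend γ₁ := by rw [hε]; abel
    rw [← innerF_smul_right, e, innerF_add_right, innerF_add_right]; ring
  rw [i4] at i1
  have p1 := innerF_self_nonneg hpos γ₀
  have p2 := innerF_self_nonneg hpos (dbarAdj N E.toZeroOneConnection x)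
  rw [← i1] at p1
  rw [i2]
  rw [← i3] at p2 ⊢
  -- With X, Y, Z real arithmetic remains: ‖γ₀‖² ≥ 0 is the estimate with weight m instead of m + 1
  -- on the Z-term, and `p2` gives that term the sign needed to pass to m + 1.
  generalize innerF K φ H x x = X at *
  generalize innerF K φ H x δ₁ = Y at *
  generalize innerF K φ H x (E.extend γ₁) = Z at *
  generalize n - k = m at *
  simp at p1 p2 ⊢
  have hm : (0 : ℝ) ≤ m := Nat.cast_nonneg m
  nlinarith

end Estimate

/-! ### Decomposition of anti-holomorphic forms by degree -/

section AntiHolomorphic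

theorem antiHolForms_le (C : ComplexStructure Ω) [Module C.base F] :
    antiHolForms C F ≤ ⨆ k : ℕ, formsIn F (C.bi (0, k)) := by
  refine Submodule.span_le.2 ?_
  rintro _ ⟨ω, hω, f, rfl⟩
  induction hω using Submodule.iSup_induction' with
  | mem k ω hω => exact Submodule.mem_iSup_of_mem k (tmul_mem_formsIn hω f)
  | zero => simp [tmul]
  | add ω η _ _ h h' => rw [tmul_add_left]; exact add_mem h h'

theorem formsIn_le_antiHolForms (C : ComplexStructure Ω) [Module C.base F] (k : ℕ) :
    formsIn F (C.bi (0, k)) ≤ antiHolForms C F :=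
  formsIn_mono (le_iSup (fun k => C.bi (0, k)) k)

/-- To map the anti-holomorphic forms into a subspace it suffices to do so in each degree. -/
theorem map_antiHolForms {C : ComplexStructure Ω} [Module C.base F]
    {S : Submodule ℂ (Forms C.base F)} {u : Forms C.base F →ₗ[ℂ] Forms C.base F}
    (h : ∀ k, ∀ x ∈ formsIn F (C.bi (0, k)), u x ∈ S)
    {x : Forms C.base F} (hx : x ∈ antiHolForms C F) : u x ∈ S := by
  have : (⨆ k : ℕ, formsIn F (C.bi (0, k))) ≤ S.comap u := iSup_le h
  exact this (antiHolForms_le C hx)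

theorem eqOn_antiHolForms {C : ComplexStructure Ω} [Module C.base F]
    {u v : Forms C.base F →ₗ[ℂ] Forms C.base F}
    (h : ∀ k, ∀ x ∈ formsIn F (C.bi (0, k)), u x = v x)
    {x : Forms C.base F} (hx : x ∈ antiHolForms C F) : u x = v x := by
  have : (⨆ k : ℕ, formsIn F (C.bi (0, k))) ≤ LinearMap.eqLocus u v := iSup_le h
  exact this (antiHolForms_le C hx)

/-- On anti-holomorphic forms the projections to the degrees 0, …, n add up to the identity, since
higher degrees vanish. -/
theorem exists_projF_ne_zero (K : KahlerStructure Ω n) [Module K.base F] {x : Forms K.base F}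
    (hx : x ∈ antiHolForms K.toComplexStructure F) (h0 : x ≠ 0) :
    ∃ k, projF K.toComplexStructure F (0, k) x ≠ 0 := by
  by_contra! h
  have e : (∑ k ∈ Finset.range (n + 1), projF K.toComplexStructure F (0, k)) x = x := by
    refine eqOn_antiHolForms (v := LinearMap.id) (fun k y hy => ?_) hx
    rw [LinearMap.sum_apply, LinearMap.id_apply]
    by_cases hk : k ≤ n
    · rw [Finset.sum_eq_single k, projF_of_mem hy]
      · exact fun l _ hl => projF_of_mem_ne (by simpa using hl.symm) hy
      · intro hk'; simp at hk'; omega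
    · rw [formsIn_eq_bot K (Or.inr (by simp; omega)), Submodule.mem_bot] at hy
      simp [hy]
  refine h0 ?_
  rw [← e, LinearMap.sum_apply]
  exact Finset.sum_eq_zero fun k _ => h k

theorem projF_mem {C : ComplexStructure Ω} [Module C.base F] (p : ℕ × ℕ) (x : Forms C.base F) :
    projF C F p x ∈ formsIn F (C.bi p) := by
  induction x using forms_induction with
  | zero => rw [map_zero]; exact zero_mem _
  | add x y hx hy => rw [map_add]; exact add_mem hx hy
  | tmul ω f =>
    refine tmul_mem_formsIn ?_ f
    rw [GradedAlgebra.proj_apply]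
    exact SetLike.coe_mem _

end AntiHolomorphic

/-! ### Eigenvalues of the Laplace operator -/

section Spectrum

variable {K : KahlerStructure Ω n} [Module K.base F] [IsScalarTower ℂ K.base F] {φ : K.State}
  {H : HermitianForm K.toStarCalculus F} {E : HolomorphicStructure K.toComplexStructure F}
  {N : Connection K.toDifferentialCalculus F}

theorem isAdjoint_dbarAdj (hφ : K.ClosedIntegral φ) (hN : IsChernConnection H E N) :
    IsAdjoint K φ H E.extend (dbarAdj N E.toZeroOneConnection) := isAdjoint_extend hφ hN

theorem dolbeaultDirac_apply (hφ : K.ClosedIntegral φ) (hpos : InnerPosDef K φ H)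
    (hN : IsChernConnection H E N) (x : Forms K.base F) :
    dolbeaultDirac K φ H E x = E.extend x + dbarAdj N E.toZeroOneConnection x := by
  rw [dolbeaultDirac, adjointF_eq hpos (isAdjoint_dbarAdj hφ hN)]
  rfl

theorem laplace_apply (hφ : K.ClosedIntegral φ) (hpos : InnerPosDef K φ H)
    (hN : IsChernConnection H E N) (x : Forms K.base F) :
    laplace K φ H E x = E.extend (dbarAdj N E.toZeroOneConnection x) +
      dbarAdj N E.toZeroOneConnection (E.extend x) := by
  rw [laplace, LinearMap.comp_apply, dolbeaultDirac_apply hφ hpos hN,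
    dolbeaultDirac_apply hφ hpos hN, map_add, map_add, E.extend_extend,
    adjoint_comp_self_eq_zero hpos (isAdjoint_dbarAdj hφ hN) E.extend_extend, zero_add, add_zero]

theorem dolbeaultDirac_mem (hφ : K.ClosedIntegral φ) (hpos : InnerPosDef K φ H)
    (hN : IsChernConnection H E N) {x : Forms K.base F}
    (hx : x ∈ antiHolForms K.toComplexStructure F) :
    dolbeaultDirac K φ H E x ∈ antiHolForms K.toComplexStructure F := by
  refine map_antiHolForms (fun k y hy => ?_) hx
  rw [dolbeaultDirac_apply hφ hpos hN]
  refine add_mem (formsIn_le_antiHolForms _ _ (E.extend_mem hy)) ?_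
  cases k with
  | zero => rw [dbarAdj_zero hN.2 hy]; exact zero_mem _
  | succ m => exact formsIn_le_antiHolForms _ _ (dbarAdj_mem hN.2 hy)

theorem laplace_mem (hφ : K.ClosedIntegral φ) (hpos : InnerPosDef K φ H)
    (hN : IsChernConnection H E N) {k : ℕ} {x : Forms K.base F}
    (hx : x ∈ formsIn F (K.bi (0, k))) : laplace K φ H E x ∈ formsIn F (K.bi (0, k)) := by
  rw [laplace_apply hφ hpos hN]
  refine add_mem ?_ (dbarAdj_mem hN.2 (E.extend_mem hx))
  cases k with
  | zero => rw [dbarAdj_zero hN.2 hx, map_zero]; exact zero_mem _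
  | succ m => exact E.extend_mem (dbarAdj_mem hN.2 hx)

/-- The Dirac operator mixes degrees but its square does not, so the homogeneous components of a
Laplace eigenvector are zero or again eigenvectors. -/
theorem laplace_projF (hφ : K.ClosedIntegral φ) (hpos : InnerPosDef K φ H)
    (hN : IsChernConnection H E N) (k : ℕ) {x : Forms K.base F}
    (hx : x ∈ antiHolForms K.toComplexStructure F) :
    laplace K φ H E (projF K.toComplexStructure F (0, k) x) =
      projF K.toComplexStructure F (0, k) (laplace K φ H E x) := by
  refine eqOn_antiHolForms (u := laplace K φ H E ∘ₗ projF K.toComplexStructure F (0, k))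
    (v := projF K.toComplexStructure F (0, k) ∘ₗ laplace K φ H E) (fun l y hy => ?_) hx
  simp only [LinearMap.comp_apply]
  have hm := laplace_mem hφ hpos hN hy
  by_cases hl : l = k
  · subst hl
    rw [projF_of_mem hy, projF_of_mem hm]
  · rw [projF_of_mem_ne (by simpa using hl) hy, projF_of_mem_ne (by simpa using hl) hm, map_zero]

/-- Since ⟨x, Δx⟩ = ‖∂̄_F†x‖² + ‖∂̄_F x‖² is real and at least θ(n-k)‖x‖², so is the conjugate of c
times ‖x‖²; and n - k ≥ 1. -/
theorem eigenvalue_of_lt (hφ : K.ClosedIntegral φ) (hpos : InnerPosDef K φ H)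
    (hN : IsChernConnection H E N) {θ : ℝ} (hθ0 : 0 < θ)
    (hθ : ∀ f : F, N.curvature f = ((θ : ℂ) * Complex.I) • tmul K.base K.κ f) {k : ℕ} (hk : k < n)
    {x : Forms K.base F} (hx : x ∈ formsIn F (K.bi (0, k))) (h0 : x ≠ 0) {c : ℂ}
    (hc : laplace K φ H E x = c • x) : c.im = 0 ∧ θ ≤ c.re := by
  have hadj := isAdjoint_dbarAdj hφ hN
  have h1 := nakano_estimate hφ hpos hN hθ hk hx
  have h2 : innerF K φ H x (laplace K φ H E x) = innerF K φ H
      (dbarAdj N E.toZeroOneConnection x) (dbarAdj N E.toZeroOneConnection x) +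
      innerF K φ H (E.extend x) (E.extend x) := by
    rw [laplace_apply hφ hpos hN, innerF_add_right, isAdjoint_right hpos hadj, hadj x]
  have im1 := innerF_self_im hpos (dbarAdj N E.toZeroOneConnection x)
  have im2 := innerF_self_im hpos (E.extend x)
  obtain ⟨im0, pos0⟩ := hpos x h0
  rw [hc, innerF_smul_right] at h2
  have hre := congrArg Complex.re h2
  have him := congrArg Complex.im h2
  simp only [Complex.mul_re, Complex.mul_im, Complex.conj_re, Complex.conj_im, Complex.add_re,
    Complex.add_im, im0, im1, im2, mul_zero, sub_zero, add_zero, zero_add] at hre him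
  refine ⟨by simpa [pos0.ne'] using him, ?_⟩
  have hM : (1 : ℝ) ≤ (n - k : ℕ) := by exact_mod_cast (by omega : 1 ≤ n - k)
  have h3 : θ * (n - k : ℕ) ≤ c.re := le_of_mul_le_mul_right (by rw [hre]; linarith) pos0
  exact (le_mul_of_one_le_right hθ0.le hM).trans h3

theorem eigenvalue_of_homogeneous (hφ : K.ClosedIntegral φ) (hpos : InnerPosDef K φ H)
    (hN : IsChernConnection H E N) {θ : ℝ} (hθ0 : 0 < θ)
    (hθ : ∀ f : F, N.curvature f = ((θ : ℂ) * Complex.I) • tmul K.base K.κ f) {k : ℕ}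
    {x : Forms K.base F} (hx : x ∈ formsIn F (K.bi (0, k))) (h0 : x ≠ 0) {c : ℂ} (hc0 : c ≠ 0)
    (hc : laplace K φ H E x = c • x) : c.im = 0 ∧ θ ≤ c.re := by
  rcases lt_trichotomy k n with hk | rfl | hk
  · exact eigenvalue_of_lt hφ hpos hN hθ0 hθ hk hx h0 hc
  · have hE := E.extend_mem hx
    rw [formsIn_eq_bot K (Or.inr (by simp)), Submodule.mem_bot] at hE
    have hc' := hc
    rw [laplace_apply hφ hpos hN, hE, map_zero, add_zero] at hc'
    have hS : dbarAdj N E.toZeroOneConnection x ≠ 0 := by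
      intro hS
      rw [hS, map_zero] at hc'
      exact smul_ne_zero hc0 h0 hc'.symm
    cases k with
    | zero => exact absurd (dbarAdj_zero hN.2 hx) hS
    | succ m =>
      -- In top degree Δ = ∂̄_F∂̄_F†, so the non-zero form ∂̄_F†x is an eigenvector for the same c
      -- one degree lower, where the estimate applies.
      refine eigenvalue_of_lt hφ hpos hN hθ0 hθ (Nat.lt_succ_self m) (dbarAdj_mem hN.2 hx) hS ?_
      rw [laplace_apply hφ hpos hN, hc',
        adjoint_comp_self_eq_zero hpos (isAdjoint_dbarAdj hφ hN) E.extend_extend, map_zero,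
        zero_add, map_smul]
  · rw [formsIn_eq_bot K (Or.inr hk), Submodule.mem_bot] at hx
    exact absurd hx h0

/-- Non-zero eigenvalues of the Laplace operator of a negative module are real and at least `θ`. -/
theorem laplace_eigenvalue (hφ : K.ClosedIntegral φ) (hpos : InnerPosDef K φ H) {θ : ℝ}
    (hneg : IsNegativeModule K H E θ) {c : ℂ} (hc0 : c ≠ 0)
    (hc : IsEigenvalueOn (laplace K φ H E) (antiHolForms K.toComplexStructure F) c) :
    c.im = 0 ∧ θ ≤ c.re := by
  obtain ⟨hθ0, N, hN, hθ⟩ := hneg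
  obtain ⟨x, hx, h0, hxc⟩ := hc
  obtain ⟨k, hk⟩ := exists_projF_ne_zero K hx h0
  refine eigenvalue_of_homogeneous hφ hpos hN hθ0 hθ (projF_mem _ _) hk hc0 ?_
  rw [laplace_projF hφ hpos hN k hx, hxc, map_smul]

end Spectrum

end NCKahler

end

/-! ### The spectral gap for Δ and D -/

open NCKahler in
theorem mainTheorem4 {Ω : Type*} [Ring Ω] [Algebra ℂ Ω] {n : ℕ}
    (K : KahlerStructure Ω n) (φ : K.State) (hclosed : K.ClosedIntegral φ)
    {F : Type*} [AddCommGroup F] [Module ℂ F] [Module K.base F] [IsScalarTower ℂ K.base F]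
    [Module.Finite K.base F] [Module.Projective K.base F]
    (H : HermitianForm K.toStarCalculus F) (E : HolomorphicStructure K.toComplexStructure F)
    (hpos : InnerPosDef K φ H)
    (θ : ℝ) (hneg : IsNegativeModule K H E θ) :
    IsAdjointable K φ H E.extend ∧
    (∀ α ∈ antiHolForms K.toComplexStructure F,
      dolbeaultDirac K φ H E α ∈ antiHolForms K.toComplexStructure F) ∧
    (IsDiagonalisableOn (dolbeaultDirac K φ H E) (antiHolForms K.toComplexStructure F) →
      (∀ c : ℂ, c ≠ 0 →
        IsEigenvalueOn (laplace K φ H E) (antiHolForms K.toComplexStructure F) c →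
          c.im = 0 ∧ θ ≤ c.re) ∧
      (∀ c : ℂ, c ≠ 0 →
        IsEigenvalueOn (dolbeaultDirac K φ H E) (antiHolForms K.toComplexStructure F) c →
          Real.sqrt θ ≤ ‖c‖)) := by
  obtain ⟨-, N, hN, -⟩ := id hneg
  refine ⟨⟨_, isAdjoint_dbarAdj hclosed hN⟩, fun α hα => dolbeaultDirac_mem hclosed hpos hN hα,
    fun _ => ⟨fun c hc0 hc => laplace_eigenvalue hclosed hpos hneg hc0 hc, fun c hc0 hc => ?_⟩⟩
  obtain ⟨x, hx, h0, hxc⟩ := hc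
  -- An eigenvector of D for c is an eigenvector of Δ = D² for c², and Re c² ≤ |c|².
  have h := (laplace_eigenvalue hclosed hpos hneg (pow_ne_zero 2 hc0) ⟨x, hx, h0, by
    rw [laplace, LinearMap.comp_apply, hxc, map_smul, hxc, smul_smul, pow_two]⟩).2
  refine Real.sqrt_le_iff.2 ⟨norm_nonneg c, h.trans ?_⟩
  rw [← norm_pow]
  exact Complex.re_le_norm _
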